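/- The multiple gamma functions $\Gamma_n$ ($n\ge 1$) are the meromorphic functions on $\mathbb C$ given by $\Gamma_1=\Gamma$, $\Gamma_{n+1}(z+1)=\Gamma_{n+1}(z)/\Gamma_n(z)$, $\Gamma_n(1)=1$, with the usual regularity condition that makes them unique (on $(0,\infty)$, $\Gamma_n$ is positive and $(-1)^{n+1}\frac{d^{n+1}}{dx^{n+1}}\log\Gamma_n(x)\ge 0$). Let $G=1/\Gamma_2$ be the Barnes function. Then for every complex number $x$ with $\Re(x)>-\frac12$ that is not one of the positive integers $1,2,3,\dots$ (where the factor with $k=2x$ on the left is undefined), $$\lim_{N\to\infty}\prod_{k=1}^{2N}\Bigl(1-\frac{4x^2}{k^2}\Bigr)^{-k^2(-1)^k}=\frac{\cos(\pi x)}{\pi}\,\exp\Bigl(2x^2+\frac{7\zeta(3)}{2\pi^2}\Bigr)\,\bigl(G(1+x)\,G(1-x)\bigr)^4\left(\frac{\Gamma_3(1-x)\,\Gamma_3(1+x)}{\Gamma_3(\frac32-x)\,\Gamma_3(\frac32+x)}\right)^8 ,$$ where the limit exists and $1/\Gamma_3$ is read as an entire function, equal to $0$ at the poles $0,-1,-2,\dots$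 of $\Gamma_3$. -/

import Mathlib

/-- Values at the positive integers of the multiple gamma functions: `multiGammaNat n N` is
`Γ_n(N + 1)`, as it is determined by `Γ_0(z) = 1 / z`, `Γ_{n+1}(1) = 1` and
`Γ_{n+1}(z + 1) = Γ_{n+1}(z) / Γ_n(z)`.  In particular `Γ_1(N + 1) = N !`. -/
noncomputable def multiGammaNat : ℕ → ℕ → ℝ
  | 0, N => 1 / ((N : ℝ) + 1)
  | n + 1, N => ∏ k ∈ Finset.range N, (multiGammaNat n k)⁻¹

/-- The multiple gamma functions `Γ_n` on `ℂ`, with `Γ_0(z) = 1 / z`, `Γ_1 = Γ`, and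
`Γ_{n+1}(z + 1) = Γ_{n+1}(z) / Γ_n(z)`, `Γ_{n+1}(1) = 1`.

The recurrence and the normalization determine `Γ_{n+1}` only up to a periodic factor. As usual,
the solution meant is the one that is asymptotically regular (equivalently, the one whose logarithm
on `(0, ∞)` satisfies the Bohr-Mollerup-Vignéras convexity condition of order `n + 2`). It is
built by Gauss's limit: the recurrence gives
`Γ_{n+1}(z) = Γ_n(z) Γ_n(z + 1) ⋯ Γ_n(z + M - 1) Γ_{n+1}(z + M)`,
and the last factor is asymptotic, for `M → ∞`, to the Newton interpolation
`∏_{j=0}^{n+1} Γ_{n+1-j}(M) ^ ((-1)^j (z choose j))` of `Γ_{n+1}` from the integers near `M`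
(the `j`-th forward difference of `log Γ_{n+1}` is `(-1)^j log Γ_{n+1-j}`). With `n = 0` this is
Gauss's product `Γ(z) = lim (M - 1)! M^z / (z (z + 1) ⋯ (z + M - 1))`.
Below, `n + 2` stands for the index of the function and `M = N + 1`.

For `n ≥ 1` the function `Γ_n` has no zeros, and its poles are the points `0, -1, -2, …`. There
the value here is `0`, as for `Complex.Gamma`, so that `(multiGamma n z)⁻¹` is everywhere the value
of the entire function `1 / Γ_n`. -/
noncomputable def multiGamma : ℕ → ℂ → ℂ
  | 0, z => z⁻¹
  | 1, z => Complex.Gamma z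
  | n + 2, z => Filter.limUnder Filter.atTop fun N : ℕ =>
      (∏ k ∈ Finset.range (N + 1), multiGamma (n + 1) (z + k)) *
        ∏ j ∈ Finset.range (n + 3),
          (multiGammaNat (n + 2 - j) N : ℂ) ^ ((-1 : ℂ) ^ j * Ring.choose z j)

/-- The Barnes function `G = 1 / Γ_2`. -/
noncomputable def barnesG (z : ℂ) : ℂ := (multiGamma 2 z)⁻¹

/-! Write Q(x) for the factor built from G and Γ_3 (`gammaQuotient`). Splitting M factors off each
Γ_2 and Γ_3 by the functional equation leaves a rational product and values of Γ_1, Γ_2, Γ_3 shifted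
by M. These obey a Binet formula (`multiGamma_eq_multiGammaBinet`): for Re w > -(M+1), a logarithm
of Γ_n(1+w+M) is the Newton interpolation from the integers near M+1 plus ∫ e^{-(M+1)t} R_n(w,t) /
(t(1-e^{-t})^n) dt, with R_n the remainder in the binomial expansion of e^{-wt}. It is proved by
induction on n from Frullani's integral, together with the convergence of Gauss's limit.

The exponents 4 and 8 in Q make the x-dependence of the Newton parts cancel (`logNewton_quotient`).
Hence Q(x) = Q(0) H_M(x) exp(T_M(x)) (`gammaQuotient_eq_headProd`), where H_M is a rational product
and T_M a Laplace-type integral tending to 2x² (`tendsto_tailIntegral`). For odd k write k² = (k²-1)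
+ 1: the exponents k²-1 belong to H_N, the remaining 1's form Euler's cosine product, and the factor
k = 2N+1, needed to complete the pattern, tends to e^{-4x²} (`prod_Icc_eq_headProd`). So the limit
is cos(πx) e^{2x²} Q(x)/Q(0).

For Q(0), take x = 1/2 and M = 0. The recurrence gives Q(1/2) = π²/Q(0), so Q(0)² = π²
exp(-T_0(1/2)). Up to a factor 4, T_0(1/2) is the Mellin transform at s = 0 of ∑ (-1)^{k-1} k²
e^{-kt}, i.e. the limit of Γ(s)η(s-2), with η(s) = ∑ (-1)^{k-1} k^{-s}: a pole against a zero. The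
functional equation evaluates it, giving T_0(1/2) = 7ζ(3)/π². -/

open Filter MeasureTheory Set Topology

/-! ### Binomial remainders and Binet-type integrals -/

/-- The remainder after `n + 1` terms of the binomial expansion of `e^{-wt}` in powers of
`1 - e^{-t}`. -/
noncomputable def binomRem (n : ℕ) (w : ℂ) (t : ℝ) : ℂ :=
  Complex.exp (-w * t) - ∑ j ∈ Finset.range (n + 1), Ring.choose w j * ((Real.exp (-t) - 1 : ℝ) : ℂ) ^ j

/-- The binomial remainder divided by `t (1 - e^{-t})^n`. -/
noncomputable def binetKernel (n : ℕ) (w : ℂ) (t : ℝ) : ℂ :=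
  binomRem n w t / (t * ((1 - Real.exp (-t) : ℝ) : ℂ) ^ n)

/-- The Binet-type integral that measures how far `log Γ_n` is from its Newton interpolation. -/
noncomputable def binetIntegral (n : ℕ) (w : ℂ) (M : ℝ) : ℂ :=
  ∫ t in Ioi (0 : ℝ), Real.exp (-M * t) * binetKernel n w t

theorem Complex.succ_mul_choose_succ (w : ℂ) (n : ℕ) :
    ((n : ℂ) + 1) * Ring.choose w (n + 1) = w * Ring.choose (w - 1) n := by
  have h1 := Ring.descPochhammer_eq_factorial_smul_choose w (n + 1)
  have h2 := Ring.descPochhammer_eq_factorial_smul_choose (w - 1) n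
  rw [descPochhammer_succ_left, Polynomial.smeval_X_mul, Polynomial.smeval_comp,
    Polynomial.smeval_sub, Polynomial.smeval_X, pow_one, ← Nat.cast_one, Polynomial.smeval_natCast,
    pow_zero, nsmul_eq_mul, mul_one, Nat.cast_one, h2, nsmul_eq_mul, nsmul_eq_mul, Nat.factorial_succ] at h1
  have h3 : (n.factorial : ℂ) ≠ 0 := by exact_mod_cast n.factorial_ne_zero
  apply mul_left_cancel₀ h3
  push_cast at h1
  linear_combination -h1

theorem binomRem_zero_right (n : ℕ) (w : ℂ) : binomRem n w 0 = 0 := by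
  simp [binomRem, Finset.sum_range_succ']

theorem binomRem_succ_eq (n : ℕ) (w : ℂ) (t : ℝ) :
    binomRem (n + 1) w t = binomRem n w t -
      Ring.choose w (n + 1) * ((Real.exp (-t) - 1 : ℝ) : ℂ) ^ (n + 1) := by
  rw [binomRem, Finset.sum_range_succ, binomRem]; ring

/-- Pascal's rule, with e^{-(w+1)t} = e^{-wt} e^{-t}. -/
theorem binomRem_succ_add_one (n : ℕ) (w : ℂ) (t : ℝ) :
    binomRem (n + 1) (w + 1) t = binomRem (n + 1) w t -
      ((1 - Real.exp (-t) : ℝ) : ℂ) * binomRem n w t := by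
  have h : ∀ n, binomRem (n + 1) (w + 1) t = Complex.exp (-w * t) * Real.exp (-t) - 1
      - ∑ j ∈ Finset.range (n + 1), (Ring.choose w j + Ring.choose w (j + 1)) *
        ((Real.exp (-t) - 1 : ℝ) : ℂ) ^ (j + 1) := by
    intro n
    rw [binomRem, Finset.sum_range_succ', Ring.choose_zero_right, pow_zero, mul_one,
      Complex.ofReal_exp, ← Complex.exp_add]
    simp only [Ring.choose_succ_succ]
    rw [show -(w + 1) * (t : ℂ) = -w * t + ((-t : ℝ) : ℂ) by push_cast; ring]
    ring
  rw [h, binomRem, binomRem, Finset.sum_range_succ' _ (n + 1), Ring.choose_zero_right]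
  simp only [add_mul, Finset.sum_add_distrib]
  have h2 : ∑ j ∈ Finset.range (n + 1), Ring.choose w j * ((Real.exp (-t) - 1 : ℝ) : ℂ) ^ (j + 1) =
      (Real.exp (-t) - 1 : ℝ) * ∑ j ∈ Finset.range (n + 1), Ring.choose w j *
        ((Real.exp (-t) - 1 : ℝ) : ℂ) ^ j := by
    rw [Finset.mul_sum]; exact Finset.sum_congr rfl fun j _ => by ring
  rw [h2]
  push_cast
  ring

theorem hasDerivAt_binomRem_zero (w : ℂ) (t : ℝ) :
    HasDerivAt (binomRem 0 w) (-w * Complex.exp (-w * t)) t := by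
  have h : HasDerivAt (fun t : ℝ => -w * (t : ℂ)) (-w) t := by
    simpa using (Complex.ofRealCLM.hasDerivAt (x := t)).const_mul (-w)
  have h2 := h.cexp.sub_const 1
  have e : binomRem 0 w = fun t : ℝ => Complex.exp (-w * t) - 1 := by
    funext t; simp [binomRem]
  rw [e]
  exact h2.congr_deriv (by ring)

/-- Rests on (j+1) C(w,j+1) = w C(w-1,j). Differentiation lowers the order by one, which drives the
induction for the vanishing order at 0. -/
theorem hasDerivAt_binomRem_succ (n : ℕ) (w : ℂ) (t : ℝ) :
    HasDerivAt (binomRem (n + 1) w) (-w * Real.exp (-t) * binomRem n (w - 1) t) t := by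
  have hr : HasDerivAt (fun t : ℝ => ((Real.exp (-t) - 1 : ℝ) : ℂ)) (-(Real.exp (-t) : ℂ)) t := by
    have := ((hasDerivAt_neg t).exp.sub_const 1).ofReal_comp
    exact this.congr_deriv (by push_cast; ring)
  induction n with
  | zero =>
    have h := (hasDerivAt_binomRem_zero w t).sub (hr.const_mul (Ring.choose w 1))
    have e : binomRem 1 w = fun t : ℝ => binomRem 0 w t -
        Ring.choose w 1 * ((Real.exp (-t) - 1 : ℝ) : ℂ) := by
      funext t; rw [binomRem_succ_eq]; simp
    rw [e]
    refine h.congr_deriv ?_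
    rw [Ring.choose_one_right]
    simp only [binomRem, zero_add, Finset.range_one, Finset.sum_singleton, Ring.choose_zero_right,
      pow_zero, mul_one]
    have : Complex.exp (-w * t) = Real.exp (-t) * Complex.exp (-(w - 1) * t) := by
      rw [Complex.ofReal_exp, ← Complex.exp_add]; congr 1; push_cast; ring
    rw [this]; ring
  | succ n ih =>
    have h := ih.sub ((hr.pow (n + 2)).const_mul (Ring.choose w (n + 2)))
    have e : binomRem (n + 1 + 1) w = fun t : ℝ => binomRem (n + 1) w t -
        Ring.choose w (n + 2) * ((Real.exp (-t) - 1 : ℝ) : ℂ) ^ (n + 2) := by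
      funext t; rw [binomRem_succ_eq]
    rw [e]
    refine h.congr_deriv ?_
    rw [binomRem_succ_eq]
    have hc := Complex.succ_mul_choose_succ w (n + 1)
    push_cast at hc ⊢
    linear_combination (Complex.exp (-t) * (Complex.exp (-t) - 1) ^ (n + 1)) * hc

theorem continuous_binomRem (n : ℕ) (w : ℂ) : Continuous (binomRem n w) := by
  unfold binomRem; fun_prop

theorem exists_norm_binomRem_le_pow (n : ℕ) (w : ℂ) :
    ∃ C, 0 ≤ C ∧ ∀ t ∈ Icc (0 : ℝ) 1, ‖binomRem n w t‖ ≤ C * t ^ (n + 1) := by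
  induction n generalizing w with
  | zero =>
    refine ⟨‖w‖ * Real.exp ‖w‖, by positivity, fun t ht => ?_⟩
    have := norm_image_sub_le_of_norm_deriv_le_segment' (f := binomRem 0 w) (a := 0) (b := 1)
      (C := ‖w‖ * Real.exp ‖w‖) (fun x _ => (hasDerivAt_binomRem_zero w x).hasDerivWithinAt)
      (fun x hx => ?_) t ht
    · simpa [binomRem_zero_right] using this
    · rw [norm_mul, norm_neg]
      gcongr
      refine (Complex.norm_exp_le_exp_norm _).trans (Real.exp_le_exp.2 ?_)
      rw [norm_mul, norm_neg, Complex.norm_real, Real.norm_of_nonneg hx.1]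
      exact mul_le_of_le_one_right (norm_nonneg _) hx.2.le
  | succ n ih =>
    obtain ⟨C, hC, h⟩ := ih (w - 1)
    refine ⟨‖w‖ * C, by positivity, fun t ht => ?_⟩
    have := norm_image_sub_le_of_norm_deriv_le_segment' (f := binomRem (n + 1) w) (a := 0) (b := t)
      (C := ‖w‖ * C * t ^ (n + 1))
      (fun x _ => (hasDerivAt_binomRem_succ n w x).hasDerivWithinAt)
      (fun x hx => ?_) t ⟨ht.1, le_rfl⟩
    · rw [binomRem_zero_right, sub_zero, sub_zero] at this
      exact this.trans_eq (by ring)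
    · rw [norm_mul, norm_mul, norm_neg, Complex.norm_real, Real.norm_of_nonneg (Real.exp_pos _).le]
      have h1 : Real.exp (-x) ≤ 1 := Real.exp_le_one_iff.2 (by linarith [hx.1])
      have h2 := h x ⟨hx.1, hx.2.le.trans ht.2⟩
      have h3 : x ^ (n + 1) ≤ t ^ (n + 1) := pow_le_pow_left₀ hx.1 hx.2.le _
      calc ‖w‖ * Real.exp (-x) * ‖binomRem n (w - 1) x‖ ≤ ‖w‖ * 1 * (C * t ^ (n + 1)) := by
            gcongr; exact h2.trans (by gcongr)
        _ = _ := by ring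

theorem half_le_one_sub_exp_neg {t : ℝ} (h0 : 0 ≤ t) (h1 : t ≤ 1) : t / 2 ≤ 1 - Real.exp (-t) := by
  have h := Real.exp_bound_div_one_sub_of_interval h0
  have h2 : t + 1 ≤ Real.exp t := Real.add_one_le_exp t
  rw [Real.exp_neg]
  have h3 : (Real.exp t)⁻¹ ≤ (t + 1)⁻¹ := inv_anti₀ (by linarith) h2
  have h4 : (t + 1)⁻¹ ≤ 1 - t / 2 := by
    rw [inv_le_iff_one_le_mul₀ (by linarith)]; nlinarith
  linarith

theorem one_sub_exp_neg_pos {t : ℝ} (h : 0 < t) : 0 < 1 - Real.exp (-t) := by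
  have : Real.exp (-t) < 1 := Real.exp_lt_one_iff.mpr (by linarith)
  linarith

/-- The remainder vanishes to order n+1 at 0, exactly as the denominator does; at infinity only
e^{-wt} can grow. -/
theorem exists_norm_binetKernel_le (n : ℕ) (w : ℂ) {a : ℝ} (ha : 0 ≤ a) (haw : -w.re ≤ a) :
    ∃ C, 0 ≤ C ∧ ∀ t, 0 < t → ‖binetKernel n w t‖ ≤ C * Real.exp (a * t) := by
  obtain ⟨C, hC, h⟩ := exists_norm_binomRem_le_pow n w
  set S : ℝ := ∑ j ∈ Finset.range (n + 1), ‖Ring.choose w j‖ with hS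
  have hS0 : 0 ≤ S := Finset.sum_nonneg fun _ _ => norm_nonneg _
  -- The first summand serves t ≤ 1, where 1-e^{-t} ≥ t/2; the second serves t ≥ 1, where 1-e^{-t} ≥
  -- 1/2 and the remainder is at most e^{at} + S.
  refine ⟨C * 2 ^ n + (1 + S) * 2 ^ n, by positivity, fun t ht => ?_⟩
  have hea : 1 ≤ Real.exp (a * t) := Real.one_le_exp (by positivity)
  have hq := one_sub_exp_neg_pos ht
  have hn : ‖binetKernel n w t‖ = ‖binomRem n w t‖ / (t * (1 - Real.exp (-t)) ^ n) := by
    rw [binetKernel, norm_div, norm_mul, norm_pow, Complex.norm_real, Complex.norm_real,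
      Real.norm_of_nonneg ht.le, Real.norm_of_nonneg hq.le]
  rw [hn, div_le_iff₀ (by positivity)]
  rcases le_total t 1 with h1 | h1
  · have h2 := half_le_one_sub_exp_neg ht.le h1
    calc ‖binomRem n w t‖ ≤ C * t ^ (n + 1) := h t ⟨ht.le, h1⟩
      _ = (C * 2 ^ n) * 1 * (t * (t / 2) ^ n) := by rw [div_pow]; field_simp; ring
      _ ≤ (C * 2 ^ n + (1 + S) * 2 ^ n) * Real.exp (a * t) * (t * (1 - Real.exp (-t)) ^ n) := by
        gcongr
        have : 0 ≤ (1 + S) * 2 ^ n := by positivity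
        linarith
  · have h2 : 1 / 2 ≤ 1 - Real.exp (-t) := by
      have := half_le_one_sub_exp_neg zero_le_one le_rfl
      have h3 : Real.exp (-t) ≤ Real.exp (-1) := Real.exp_le_exp.2 (by linarith)
      linarith
    have h4 : ‖binomRem n w t‖ ≤ Real.exp (a * t) + S := by
      refine (norm_sub_le _ _).trans (add_le_add ?_ ?_)
      · rw [Complex.norm_exp]
        apply Real.exp_le_exp.2
        simp only [Complex.mul_re, Complex.neg_re, Complex.ofReal_re, Complex.ofReal_im, mul_zero,
          sub_zero]
        gcongr
      · refine (norm_sum_le _ _).trans (Finset.sum_le_sum fun j _ => ?_)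
        rw [norm_mul, norm_pow, Complex.norm_real, Real.norm_eq_abs]
        refine mul_le_of_le_one_right (norm_nonneg _) (pow_le_one₀ (abs_nonneg _) ?_)
        rw [abs_le]
        constructor <;> linarith [Real.exp_pos (-t)]
    calc ‖binomRem n w t‖ ≤ Real.exp (a * t) + S * Real.exp (a * t) :=
          h4.trans (by gcongr; exact le_mul_of_one_le_right hS0 hea)
      _ = ((1 + S) * 2 ^ n) * Real.exp (a * t) * (1 * (1 / 2) ^ n) := by
        rw [div_pow, one_pow]; field_simp
      _ ≤ (C * 2 ^ n + (1 + S) * 2 ^ n) * Real.exp (a * t) * (t * (1 - Real.exp (-t)) ^ n) := by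
        gcongr
        have : 0 ≤ C * 2 ^ n := by positivity
        linarith

theorem continuousOn_binetKernel (n : ℕ) (w : ℂ) : ContinuousOn (binetKernel n w) (Ioi 0) := by
  unfold binetKernel
  refine (continuous_binomRem n w).continuousOn.div (by fun_prop) fun t ht => ?_
  have h1 : (t : ℂ) ≠ 0 := by exact_mod_cast (ne_of_gt ht)
  have h2 : ((1 - Real.exp (-t) : ℝ) : ℂ) ≠ 0 := by exact_mod_cast (one_sub_exp_neg_pos ht).ne'
  exact mul_ne_zero h1 (pow_ne_zero _ h2)

theorem integrableOn_of_norm_le_exp {f : ℝ → ℂ} (hf : ContinuousOn f (Ioi 0)) {C a M : ℝ}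
    (hb : ∀ t, 0 < t → ‖f t‖ ≤ C * Real.exp (a * t)) (hM : a < M) :
    IntegrableOn (fun t : ℝ => Real.exp (-M * t) * f t) (Ioi 0) := by
  have h := (exp_neg_integrableOn_Ioi 0 (sub_pos.2 hM)).const_mul C
  refine Integrable.mono' h ?_ ?_
  · exact ContinuousOn.aestronglyMeasurable (by fun_prop) measurableSet_Ioi
  · filter_upwards [ae_restrict_mem measurableSet_Ioi] with t ht
    rw [norm_mul, Complex.norm_real, Real.norm_of_nonneg (Real.exp_pos _).le]
    calc Real.exp (-M * t) * ‖f t‖ ≤ Real.exp (-M * t) * (C * Real.exp (a * t)) := by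
          gcongr; exact hb t ht
      _ = _ := by
        rw [mul_left_comm, ← Real.exp_add]; congr 2; ring

theorem norm_integral_le_of_norm_le_exp {f : ℝ → ℂ} {C a M : ℝ}
    (hb : ∀ t, 0 < t → ‖f t‖ ≤ C * Real.exp (a * t)) (hM : a < M) :
    ‖∫ t in Ioi (0 : ℝ), Real.exp (-M * t) * f t‖ ≤ C / (M - a) := by
  have h := (exp_neg_integrableOn_Ioi 0 (sub_pos.2 hM)).const_mul C
  refine (norm_integral_le_of_norm_le h ?_).trans_eq ?_
  · filter_upwards [ae_restrict_mem measurableSet_Ioi] with t ht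
    rw [norm_mul, Complex.norm_real, Real.norm_of_nonneg (Real.exp_pos _).le]
    calc Real.exp (-M * t) * ‖f t‖ ≤ Real.exp (-M * t) * (C * Real.exp (a * t)) := by
          gcongr; exact hb t ht
      _ = _ := by
        rw [mul_left_comm, ← Real.exp_add]; congr 2; ring
  · rw [integral_const_mul, integral_exp_mul_Ioi (by linarith)]
    rw [neg_div_neg_eq, mul_zero, Real.exp_zero, mul_one_div]

theorem integrableOn_binetKernel (n : ℕ) (w : ℂ) {M : ℝ} (hM : 0 < M) (hw : -M < w.re) :
    IntegrableOn (fun t : ℝ => Real.exp (-M * t) * binetKernel n w t) (Ioi 0) := by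
  obtain ⟨C, -, h⟩ := exists_norm_binetKernel_le n w (a := max 0 (-w.re)) (le_max_left _ _)
    (le_max_right _ _)
  exact integrableOn_of_norm_le_exp (continuousOn_binetKernel n w) h (max_lt hM (by linarith))

theorem tendsto_binetIntegral (n : ℕ) (w : ℂ) :
    Tendsto (fun M : ℝ => binetIntegral n w M) atTop (𝓝 0) := by
  obtain ⟨C, hC, h⟩ := exists_norm_binetKernel_le n w (a := max 0 (-w.re)) (le_max_left _ _)
    (le_max_right _ _)
  set a := max 0 (-w.re)
  have h1 : Tendsto (fun M : ℝ => C / (M - a)) atTop (𝓝 0) :=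
    tendsto_const_nhds.div_atTop (tendsto_atTop_add_const_right _ _ tendsto_id)
  refine squeeze_zero_norm' ?_ h1
  filter_upwards [eventually_gt_atTop a] with M hM
  exact norm_integral_le_of_norm_le_exp h hM

/-! ### Frullani's integral and the shift identities -/

theorem hasDerivAt_binetIntegral_zero {M : ℝ} (hM : 0 < M) {w : ℂ} (hw : -M < w.re) :
    HasDerivAt (fun w => binetIntegral 0 w M) (-(M + w)⁻¹) w := by
  -- Half the distance from w to the line Re = -M: on this ball the w-derivatives are dominated by
  -- one decaying exponential.
  have he : 0 < (M + w.re) / 2 := by linarith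
  have key := hasDerivAt_integral_of_dominated_loc_of_deriv_le (𝕜 := ℂ)
    (μ := volume.restrict (Ioi (0 : ℝ)))
    (F := fun w t => Real.exp (-M * t) * binetKernel 0 w t)
    (F' := fun w t => -Complex.exp (-(M + w) * t)) (x₀ := w)
    (s := Metric.ball w ((M + w.re) / 2))
    (bound := fun t => Real.exp (-((M + w.re) / 2) * t)) (Metric.ball_mem_nhds _ he)
    (Eventually.of_forall fun v => ContinuousOn.aestronglyMeasurable
      (by have := continuousOn_binetKernel 0 v; fun_prop) measurableSet_Ioi)
    (integrableOn_binetKernel 0 w hM hw)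
    (ContinuousOn.aestronglyMeasurable (by fun_prop) measurableSet_Ioi) ?_
    (exp_neg_integrableOn_Ioi 0 he) ?_
  · refine key.2.congr_deriv ?_
    rw [integral_neg, integral_exp_mul_complex_Ioi (by simp; linarith)]
    simp
    rw [show -w + -(M : ℂ) = -(M + w) by ring, neg_div_neg_eq, one_div]
  · filter_upwards [ae_restrict_mem measurableSet_Ioi] with t ht v hv
    rw [norm_neg, Complex.norm_exp]
    apply Real.exp_le_exp.2
    have h1 : |(v - w).re| < (M + w.re) / 2 :=
      (Complex.abs_re_le_norm _).trans_lt (by simpa [dist_eq_norm] using hv)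
    rw [Complex.sub_re, abs_lt] at h1
    simp only [Complex.mul_re, Complex.neg_re, Complex.add_re, Complex.ofReal_re,
      Complex.ofReal_im, mul_zero, sub_zero]
    exact mul_le_mul_of_nonneg_right (by linarith [h1.1]) (le_of_lt ht)
  · filter_upwards [ae_restrict_mem measurableSet_Ioi] with t ht v _
    have h1 : (t : ℂ) ≠ 0 := by exact_mod_cast (ne_of_gt ht)
    have h2 : HasDerivAt (fun v : ℂ => -v * (t : ℂ)) (-t) v := by
      simpa using (hasDerivAt_id v).neg.mul_const (t : ℂ)
    have h3 := ((h2.cexp.sub_const 1).div_const (t : ℂ)).const_mul (Real.exp (-M * t) : ℂ)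
    have e : (fun v => (Real.exp (-M * t) : ℂ) * binetKernel 0 v t) =
        fun v => (Real.exp (-M * t) : ℂ) * ((Complex.exp (-v * t) - 1) / t) := by
      funext v; simp [binetKernel, binomRem]
    rw [e]
    refine h3.congr_deriv ?_
    rw [show -(M + v) * (t : ℂ) = ((-M * t : ℝ) : ℂ) + -v * t by push_cast; ring, Complex.exp_add,
      Complex.ofReal_exp]
    field_simp

theorem binomRem_zero_mid (n : ℕ) (t : ℝ) : binomRem n 0 t = 0 := by
  simp [binomRem, Finset.sum_range_succ', Ring.choose_zero_succ]

theorem binetIntegral_zero_mid (n : ℕ) (M : ℝ) : binetIntegral n 0 M = 0 := by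
  simp [binetIntegral, binetKernel, binomRem_zero_mid]

/-- Frullani's log(M/(M+w)), exponentiated so that no branch of the logarithm is needed: the left
side has zero derivative on the half-plane and equals M at w = 0. -/
theorem exp_binetIntegral_zero {M : ℝ} (hM : 0 < M) {w : ℂ} (hw : -M < w.re) :
    Complex.exp (binetIntegral 0 w M) * (M + w) = M := by
  have hU : IsOpen {v : ℂ | -M < v.re} := isOpen_lt continuous_const Complex.continuous_re
  have hc : IsPreconnected {v : ℂ | -M < v.re} := (convex_halfSpace_re_gt (-M)).isPreconnected
  have hd : ∀ v ∈ {v : ℂ | -M < v.re},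
      HasDerivAt (fun v => Complex.exp (binetIntegral 0 v M) * (M + v)) 0 v := by
    intro v hv
    have hne : (M : ℂ) + v ≠ 0 := by
      intro h
      have := congrArg Complex.re h
      simp at this hv
      linarith
    refine ((hasDerivAt_binetIntegral_zero hM hv).cexp.mul
      ((hasDerivAt_id v).const_add (M : ℂ))).congr_deriv ?_
    simp only [id]
    field_simp
    ring
  have := hU.is_const_of_deriv_eq_zero hc
    (fun v hv => (hd v hv).differentiableAt.differentiableWithinAt)
    (fun v hv => (hd v hv).deriv) hw (show (0 : ℂ) ∈ {v : ℂ | -M < v.re} by simpa using hM)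
  simpa [binetIntegral_zero_mid] using this

theorem binetIntegral_zero_one {M : ℝ} (hM : 0 < M) :
    binetIntegral 0 1 M = (Real.log (M / (M + 1)) : ℝ) := by
  have h := exp_binetIntegral_zero hM (w := 1) (by simp; linarith)
  have hr : binetIntegral 0 1 M =
      ((∫ t in Ioi (0 : ℝ), Real.exp (-M * t) * ((Real.exp (-t) - 1) / t) : ℝ) : ℂ) := by
    refine Eq.trans ?_ (integral_ofReal (𝕜 := ℂ))
    refine setIntegral_congr_fun measurableSet_Ioi fun t _ => ?_
    simp [binetKernel, binomRem]
  rw [hr] at h ⊢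
  have h2 : Real.exp (∫ t in Ioi (0 : ℝ), Real.exp (-M * t) * ((Real.exp (-t) - 1) / t)) * (M + 1) = M := by
    exact_mod_cast h
  rw [← (eq_div_iff (by linarith)).2 h2, Real.log_exp]

/-- Write e^{-(M+1)t} = e^{-Mt}(1-q) with q = 1-e^{-t}. The factor q turns the kernel of order n+1
into that of order n, up to one binomial term, whose integral is Frullani's. -/
theorem binetIntegral_succ_shift (n : ℕ) (w : ℂ) {M : ℝ} (hM : 0 < M) (hw : -M < w.re) :
    binetIntegral (n + 1) w (M + 1) = binetIntegral (n + 1) w M - binetIntegral n w M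
      - (-1) ^ (n + 1) * Ring.choose w (n + 1) * (Real.log (M / (M + 1)) : ℝ) := by
  rw [← binetIntegral_zero_one hM, binetIntegral, binetIntegral, binetIntegral, binetIntegral,
    ← integral_const_mul, ← integral_sub
    (integrableOn_binetKernel _ _ hM hw) (integrableOn_binetKernel _ _ hM hw), ← integral_sub
    (Integrable.sub' (integrableOn_binetKernel _ _ hM hw) (integrableOn_binetKernel _ _ hM hw))
    ((integrableOn_binetKernel _ _ hM (by simp; linarith)).const_mul _)]
  refine setIntegral_congr_fun measurableSet_Ioi fun t ht => ?_
  have h1 : (t : ℂ) ≠ 0 := by exact_mod_cast (ne_of_gt ht)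
  have h2 : ((1 - Real.exp (-t) : ℝ) : ℂ) ≠ 0 := by exact_mod_cast (one_sub_exp_neg_pos ht).ne'
  have h3 : binetKernel 0 1 t = -((1 - Real.exp (-t) : ℝ) : ℂ) / t := by
    simp [binetKernel, binomRem]
  have h4 : Real.exp (-(M + 1) * t) = Real.exp (-M * t) * Real.exp (-t) := by
    rw [← Real.exp_add]; congr 1; ring
  have h5 : ((Real.exp (-t) - 1 : ℝ) : ℂ) = - ((1 - Real.exp (-t) : ℝ) : ℂ) := by push_cast; ring
  have h6 : (Real.exp (-t) : ℂ) = 1 - ((1 - Real.exp (-t) : ℝ) : ℂ) := by push_cast; ring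
  rw [h3]
  simp only [binetKernel, binomRem_succ_eq, h4, h5]
  rw [Complex.ofReal_mul, h6]
  set q := ((1 - Real.exp (-t) : ℝ) : ℂ)
  rw [neg_pow q]
  field_simp
  ring

/-- Up to one binomial term, raising w by 1 multiplies the remainder by e^{-t}, which is the effect
of raising M by 1. -/
theorem binetIntegral_add_one (n : ℕ) (w : ℂ) {M : ℝ} (hM : 0 < M) (hw : -(M + 1) < w.re) :
    binetIntegral (n + 1) (w + 1) M = binetIntegral (n + 1) w (M + 1)
      + (-1) ^ (n + 1) * Ring.choose w (n + 1) * (Real.log (M / (M + 1)) : ℝ) := by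
  rw [← binetIntegral_zero_one hM, binetIntegral, binetIntegral, binetIntegral,
    ← integral_const_mul, ← integral_add
    (integrableOn_binetKernel _ _ (by linarith) hw)
    ((integrableOn_binetKernel _ _ hM (by simp; linarith)).const_mul _)]
  refine setIntegral_congr_fun measurableSet_Ioi fun t ht => ?_
  have h1 : (t : ℂ) ≠ 0 := by exact_mod_cast (ne_of_gt ht)
  have h2 : ((1 - Real.exp (-t) : ℝ) : ℂ) ≠ 0 := by exact_mod_cast (one_sub_exp_neg_pos ht).ne'
  have h3 : binetKernel 0 1 t = -((1 - Real.exp (-t) : ℝ) : ℂ) / t := by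
    simp [binetKernel, binomRem]
  have h4 : Real.exp (-(M + 1) * t) = Real.exp (-M * t) * Real.exp (-t) := by
    rw [← Real.exp_add]; congr 1; ring
  have h5 : ((Real.exp (-t) - 1 : ℝ) : ℂ) = - ((1 - Real.exp (-t) : ℝ) : ℂ) := by push_cast; ring
  have h6 : (Real.exp (-t) : ℂ) = 1 - ((1 - Real.exp (-t) : ℝ) : ℂ) := by push_cast; ring
  rw [h3]
  simp only [binetKernel, binomRem_succ_add_one, binomRem_succ_eq n w, h4, h5]
  rw [Complex.ofReal_mul, h6]
  set q := ((1 - Real.exp (-t) : ℝ) : ℂ)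
  rw [neg_pow q]
  field_simp
  ring

/-! ### Newton interpolation and the Binet formula for Γ_n -/

theorem multiGammaNat_pos (n N : ℕ) : 0 < multiGammaNat n N := by
  induction n generalizing N with
  | zero => rw [multiGammaNat]; positivity
  | succ n ih => rw [multiGammaNat]; exact Finset.prod_pos fun k _ => inv_pos.2 (ih k)

theorem multiGammaNat_zero_right (n : ℕ) : multiGammaNat n 0 = 1 := by
  cases n <;> simp [multiGammaNat]

theorem multiGammaNat_one (N : ℕ) : multiGammaNat 1 N = N.factorial := by
  simp only [multiGammaNat, one_div, inv_inv]
  exact_mod_cast Finset.prod_range_add_one_eq_factorial N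

theorem log_multiGammaNat_succ (n N : ℕ) :
    Real.log (multiGammaNat (n + 1) (N + 1)) =
      Real.log (multiGammaNat (n + 1) N) - Real.log (multiGammaNat n N) := by
  rw [multiGammaNat, Finset.prod_range_succ, ← multiGammaNat,
    Real.log_mul (multiGammaNat_pos _ _).ne' (inv_pos.2 (multiGammaNat_pos _ _)).ne', Real.log_inv]
  ring

/-- The logarithm of the Newton interpolation of `Γ_n` from the integers near `N + 1`. -/
noncomputable def logNewton (n : ℕ) (w : ℂ) (N : ℕ) : ℂ :=
  ∑ j ∈ Finset.range (n + 1), (-1) ^ j * Ring.choose w j * (Real.log (multiGammaNat (n - j) N) : ℂ)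

/-- The value of `Γ_n` at `1 + w + N`, for `-(N + 1) < re w`, in terms of the Binet-type
integral. -/
noncomputable def multiGammaBinet (n : ℕ) (w : ℂ) (N : ℕ) : ℂ :=
  Complex.exp (logNewton n w N + binetIntegral n w (N + 1))

theorem logNewton_succ_add_one (n : ℕ) (w : ℂ) (N : ℕ) :
    logNewton (n + 1) (w + 1) N = logNewton (n + 1) w N - logNewton n w N := by
  simp only [logNewton]
  rw [Finset.sum_range_succ', Finset.sum_range_succ' _ (n + 1)]
  simp only [Ring.choose_succ_succ, Ring.choose_zero_right]
  rw [add_sub_right_comm, ← Finset.sum_sub_distrib]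
  congr 1
  refine Finset.sum_congr rfl fun j _ => ?_
  rw [show n + 1 - (j + 1) = n - j by omega]
  ring

/-- The recurrence lowers every index except that of the last term, log Γ_0, whose increment is
explicit. It is opposite to the Frullani term of `binetIntegral_succ_shift`, so the two cancel in
`multiGammaBinet`. -/
theorem logNewton_succ_shift (n : ℕ) (w : ℂ) (N : ℕ) :
    logNewton (n + 1) w (N + 1) = logNewton (n + 1) w N - logNewton n w N +
      (-1) ^ (n + 1) * Ring.choose w (n + 1) *
        (Real.log (((N : ℝ) + 1) / ((N : ℝ) + 1 + 1)) : ℝ) := by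
  simp only [logNewton]
  rw [Finset.sum_range_succ, Finset.sum_range_succ _ (n + 1), Nat.sub_self]
  have h0 : Real.log (multiGammaNat 0 (N + 1)) = Real.log (multiGammaNat 0 N) +
      Real.log (((N : ℝ) + 1) / ((N : ℝ) + 1 + 1)) := by
    rw [← Real.log_mul (multiGammaNat_pos _ _).ne' (by positivity)]
    congr 1
    simp only [multiGammaNat]
    push_cast
    field_simp
  rw [h0]
  have h1 : ∑ j ∈ Finset.range (n + 1), (-1) ^ j * Ring.choose w j *
        (Real.log (multiGammaNat (n + 1 - j) (N + 1)) : ℂ) =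
      ∑ j ∈ Finset.range (n + 1), (-1) ^ j * Ring.choose w j *
        (Real.log (multiGammaNat (n + 1 - j) N) : ℂ) -
      ∑ j ∈ Finset.range (n + 1), (-1) ^ j * Ring.choose w j *
        (Real.log (multiGammaNat (n - j) N) : ℂ) := by
    rw [← Finset.sum_sub_distrib]
    refine Finset.sum_congr rfl fun j hj => ?_
    have : n + 1 - j = (n - j) + 1 := by
      have := Finset.mem_range.1 hj; omega
    rw [this, log_multiGammaNat_succ]
    push_cast
    ring
  rw [h1]
  push_cast
  ring

theorem multiGammaBinet_ne_zero (n : ℕ) (w : ℂ) (N : ℕ) : multiGammaBinet n w N ≠ 0 :=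
  Complex.exp_ne_zero _

theorem multiGammaBinet_succ_shift (n : ℕ) {w : ℂ} {N : ℕ} (hw : -((N : ℝ) + 1) < w.re) :
    multiGammaBinet (n + 1) w (N + 1) * multiGammaBinet n w N = multiGammaBinet (n + 1) w N := by
  rw [multiGammaBinet, multiGammaBinet, multiGammaBinet, ← Complex.exp_add, logNewton_succ_shift,
    Nat.cast_add_one, binetIntegral_succ_shift n w (by positivity) hw]
  congr 1; ring

/-- Consistency: both sides represent the value at the same point 2+w+N. -/
theorem multiGammaBinet_add_one (n : ℕ) {w : ℂ} {N : ℕ} (hw : -((N : ℝ) + 2) < w.re) :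
    multiGammaBinet (n + 1) (w + 1) N = multiGammaBinet (n + 1) w (N + 1) := by
  rw [multiGammaBinet, multiGammaBinet, logNewton_succ_shift, logNewton_succ_add_one,
    Nat.cast_add_one, binetIntegral_add_one n w (by positivity) (by linarith)]
  congr 1; ring

theorem multiGammaBinet_add_nat (n : ℕ) {w : ℂ} {N : ℕ} (hw : -((N : ℝ) + 1) < w.re) :
    multiGammaBinet (n + 1) (w + N) 0 = multiGammaBinet (n + 1) w N := by
  induction N generalizing w with
  | zero => simp
  | succ N ih =>
    push_cast at hw
    have h1 : -((N : ℝ) + 1) < (w + 1).re := by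
      simp only [Complex.add_re, Complex.one_re]
      linarith
    push_cast
    rw [add_comm (N : ℂ) 1, ← add_assoc, ih h1]
    exact multiGammaBinet_add_one n (by linarith)

theorem multiGammaBinet_zero {w : ℂ} {N : ℕ} (hw : -((N : ℝ) + 1) < w.re) :
    multiGammaBinet 0 w N = (1 + w + N)⁻¹ := by
  have h := exp_binetIntegral_zero (M := (N : ℝ) + 1) (by positivity) hw
  have h1 : ((N : ℂ) + 1) ≠ 0 := by exact_mod_cast N.succ_ne_zero
  have h2 : (1 + w + N) ≠ 0 := by
    intro h0
    have := congrArg Complex.re h0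
    simp at this
    linarith
  rw [multiGammaBinet, Complex.exp_add]
  simp only [logNewton, multiGammaNat, zero_add, Finset.range_one, Finset.sum_singleton, pow_zero,
    Ring.choose_zero_right, mul_one, one_mul, Nat.sub_self]
  rw [← Complex.ofReal_exp, Real.exp_log (by positivity)]
  push_cast at h ⊢
  field_simp
  linear_combination h

/-- The sequence in Gauss's limit for `Γ_{n+1}(z)`. -/
noncomputable def gaussProd (n : ℕ) (z : ℂ) (N : ℕ) : ℂ :=
  (∏ k ∈ Finset.range (N + 1), multiGamma n (z + k)) *
    ∏ j ∈ Finset.range (n + 2),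
      (multiGammaNat (n + 1 - j) N : ℂ) ^ ((-1 : ℂ) ^ j * Ring.choose z j)

theorem gaussProd_eq (n : ℕ) (z : ℂ) (N : ℕ) : gaussProd n z N =
    (∏ k ∈ Finset.range (N + 1), multiGamma n (z + k)) * Complex.exp (logNewton (n + 1) z N) := by
  rw [gaussProd, logNewton, Complex.exp_sum]
  congr 1
  refine Finset.prod_congr rfl fun j _ => ?_
  have h := multiGammaNat_pos (n + 1 - j) N
  rw [Complex.cpow_def_of_ne_zero (by exact_mod_cast h.ne'), ← Complex.ofReal_log h.le, mul_comm]

/-- If `Γ_n` has the Binet-type representation, then Gauss's limit for `Γ_{n+1}` exists. -/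
theorem tendsto_gaussProd {n : ℕ}
    (hn : ∀ (w : ℂ) (M : ℕ), -((M : ℝ) + 1) < w.re → multiGamma n (1 + w + M) = multiGammaBinet n w M)
    {z : ℂ} {M : ℕ} (hz : -((M : ℝ) + 1) < z.re) :
    Tendsto (gaussProd n z) atTop (𝓝 ((∏ k ∈ Finset.range (M + 1), multiGamma n (z + k)) *
      multiGammaBinet (n + 1) z M)) := by
  -- Each new factor Γ_n(z+N+1) is the quotient of consecutive Binet expressions, so this product is
  -- already constant.
  have hconst : ∀ N, M ≤ N → (∏ k ∈ Finset.range (N + 1), multiGamma n (z + k)) *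
      multiGammaBinet (n + 1) z N = (∏ k ∈ Finset.range (M + 1), multiGamma n (z + k)) *
      multiGammaBinet (n + 1) z M := by
    intro N hN
    induction N, hN using Nat.le_induction with
    | base => rfl
    | succ N hN ih =>
      have hz' : -((N : ℝ) + 1) < z.re := by
        have : (M : ℝ) ≤ N := by exact_mod_cast hN
        linarith
      rw [← ih, Finset.prod_range_succ, ← multiGammaBinet_succ_shift n hz', ← hn z N hz']
      push_cast
      rw [show z + ((N : ℂ) + 1) = 1 + z + N by ring]
      ring
  -- The factor by which Gauss's sequence differs from that constant.
  have hlim : Tendsto (fun N : ℕ => Complex.exp (-binetIntegral (n + 1) z ((N : ℝ) + 1))) atTop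
      (𝓝 1) := by
    have h := (tendsto_binetIntegral (n + 1) z).comp
      (tendsto_atTop_add_const_right atTop (1 : ℝ) tendsto_natCast_atTop_atTop)
    simpa using h.neg.cexp
  have := (tendsto_const_nhds (x := (∏ k ∈ Finset.range (M + 1), multiGamma n (z + k)) *
      multiGammaBinet (n + 1) z M)).mul hlim
  rw [mul_one] at this
  refine this.congr' ?_
  filter_upwards [eventually_ge_atTop M] with N hN
  rw [← hconst N hN, gaussProd_eq, multiGammaBinet, Complex.exp_add, Complex.exp_neg]
  field_simp

/-- Γ_1 is given as Γ and not as a Gauss limit, so the induction needs Euler's limit here;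
`Complex.GammaSeq` has N^z in place of (N+1)^z. -/
theorem tendsto_gaussProd_zero (z : ℂ) :
    Tendsto (gaussProd 0 z) atTop (𝓝 (Complex.Gamma z)) := by
  have h1 : Tendsto (fun N : ℕ => Complex.exp (z * (Real.log (1 + 1 / (N : ℝ)) : ℝ))) atTop (𝓝 1) := by
    have h : Tendsto (fun N : ℕ => (1 : ℝ) + 1 / (N : ℝ)) atTop (𝓝 1) := by
      simpa using tendsto_one_div_atTop_nhds_zero_nat.const_add (1 : ℝ)
    have h2 := (h.log one_ne_zero).ofReal
    simpa using (h2.const_mul z).cexp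
  have := (Complex.GammaSeq_tendsto_Gamma z).mul h1
  rw [mul_one] at this
  refine this.congr' ?_
  filter_upwards [eventually_gt_atTop 0] with N hN
  have hN' : (0 : ℝ) < N := by exact_mod_cast hN
  have hlog : Real.log (1 + 1 / (N : ℝ)) = Real.log (N + 1) - Real.log N := by
    rw [← Real.log_div (by positivity) hN'.ne']
    congr 1; field_simp
  rw [gaussProd_eq, Complex.GammaSeq, Complex.cpow_def_of_ne_zero (by exact_mod_cast hN.ne'),
    ← Complex.natCast_log, hlog]
  simp only [logNewton, multiGamma, Finset.sum_range_succ, Finset.sum_range_zero, multiGammaNat_one,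
    multiGammaNat, Finset.prod_inv_distrib, Ring.choose_zero_right, Ring.choose_one_right, zero_add,
    pow_zero, pow_one, one_mul, Nat.sub_zero, Nat.sub_self]
  rw [one_div, Real.log_inv, Complex.exp_add, ← Complex.ofReal_exp (Real.log _), Real.exp_log (by positivity),
    div_eq_mul_inv]
  have he : Complex.exp ((-1) * z * ((-Real.log (N + 1) : ℝ) : ℂ)) =
      Complex.exp ((Real.log N : ℝ) * z) * Complex.exp (z * (Real.log (N + 1) - Real.log N : ℝ)) := by
    rw [← Complex.exp_add]; congr 1; push_cast; ring
  rw [he, Complex.ofReal_natCast]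
  ring

theorem multiGamma_succ_eq_of_binet {n : ℕ}
    (hn : ∀ (w : ℂ) (M : ℕ), -((M : ℝ) + 1) < w.re → multiGamma n (1 + w + M) = multiGammaBinet n w M)
    {z : ℂ} {M : ℕ} (hz : -((M : ℝ) + 1) < z.re) :
    multiGamma (n + 1) z = (∏ k ∈ Finset.range (M + 1), multiGamma n (z + k)) *
      multiGammaBinet (n + 1) z M := by
  have h := tendsto_gaussProd hn hz
  cases n with
  | zero => rw [multiGamma]; exact tendsto_nhds_unique (tendsto_gaussProd_zero z) h
  | succ n => exact h.limUnder_eq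

theorem multiGamma_eq_multiGammaBinet (n : ℕ) : ∀ (w : ℂ) (M : ℕ), -((M : ℝ) + 1) < w.re →
    multiGamma n (1 + w + M) = multiGammaBinet n w M := by
  induction n with
  | zero => intro w M hw; rw [multiGammaBinet_zero hw, multiGamma]
  | succ n ih =>
    intro w M hw
    -- At 1+w+M, of positive real part, the splitting with a single factor is available, and the
    -- shift identity absorbs that factor.
    have h0 : -((((0 : ℕ) : ℝ)) + 1) < (1 + w + M).re := by simp; linarith
    rw [multiGamma_succ_eq_of_binet ih h0, ← multiGammaBinet_succ_shift n hw, ← ih w M hw]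
    have h1 : multiGammaBinet (n + 1) (1 + w + M) 0 = multiGammaBinet (n + 1) w (M + 1) := by
      have := multiGammaBinet_add_nat n (w := w) (N := M + 1) (by push_cast; linarith)
      rw [← this]; congr 1; push_cast; ring
    rw [h1]
    simp [mul_comm]

theorem multiGamma_succ_eq (n : ℕ) {z : ℂ} {M : ℕ} (hz : -((M : ℝ) + 1) < z.re) :
    multiGamma (n + 1) z = (∏ k ∈ Finset.range (M + 1), multiGamma n (z + k)) *
      multiGammaBinet (n + 1) z M :=
  multiGamma_succ_eq_of_binet (multiGamma_eq_multiGammaBinet n) hz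

/-- Holds at the poles too: the product formula carries the default value 0, which originates in 0⁻¹
= 0. -/
theorem multiGamma_recurrence (n : ℕ) (z : ℂ) :
    multiGamma (n + 1) z = multiGamma n z * multiGamma (n + 1) (z + 1) := by
  obtain ⟨M, hM⟩ := exists_nat_gt (-z.re)
  have h1 : -(((M + 1 : ℕ) : ℝ) + 1) < z.re := by push_cast; linarith
  have h2 : -((M : ℝ) + 1) < (z + 1).re := by simp; linarith
  rw [multiGamma_succ_eq n h1, multiGamma_succ_eq n h2, multiGammaBinet_add_one n (by linarith),
    Finset.prod_range_succ']
  simp only [Nat.cast_zero, add_zero, Nat.cast_add, Nat.cast_one]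
  simp only [add_assoc, add_comm (1 : ℂ)]
  ring

theorem multiGamma_one_right (n : ℕ) : multiGamma n 1 = 1 := by
  have := multiGamma_eq_multiGammaBinet n 0 0 (by simp)
  simp only [add_zero, Nat.cast_zero] at this
  rw [this, multiGammaBinet, binetIntegral_zero_mid, logNewton]
  simp [multiGammaNat_zero_right]

/-! ### Splitting factors off Γ_2, Γ_3 and the quotient -/

theorem multiGamma_two_eq_prod (z : ℂ) (M : ℕ) :
    multiGamma 2 z = multiGamma 2 (z + M) * multiGamma 1 (z + M) ^ M *
      ∏ i ∈ Finset.range M, ((z + i)⁻¹) ^ (i + 1) := by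
  induction M with
  | zero => simp
  | succ M ih =>
    rw [ih, Finset.prod_range_succ, multiGamma_recurrence 1 (z + M), multiGamma_recurrence 0 (z + M)]
    push_cast
    rw [← add_assoc, multiGamma]
    ring

theorem multiGamma_three_eq_prod (z : ℂ) (M : ℕ) :
    multiGamma 3 z = multiGamma 3 (z + M) * multiGamma 2 (z + M) ^ M *
      multiGamma 1 (z + M) ^ ((M + 1).choose 2) *
      ∏ i ∈ Finset.range M, ((z + i)⁻¹) ^ ((i + 2).choose 2) := by
  induction M with
  | zero => simp
  | succ M ih =>
    rw [ih, Finset.prod_range_succ, multiGamma_recurrence 2 (z + M), multiGamma_recurrence 1 (z + M),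
      multiGamma_recurrence 0 (z + M), show (M + 1 + 1).choose 2 = (M + 1).choose 2 + (M + 1) by
        rw [Nat.choose_succ_succ' (M + 1) 1, Nat.choose_one_right, add_comm]]
    push_cast
    rw [← add_assoc, multiGamma]
    ring

/-- `log Γ_n (1 + w + M)`, for `-(M + 1) < re w`. -/
noncomputable def logBinet (n : ℕ) (w : ℂ) (M : ℕ) : ℂ :=
  logNewton n w M + binetIntegral n w (M + 1)

theorem multiGamma_two_one_add {w : ℂ} {M : ℕ} (hw : -((M : ℝ) + 1) < w.re) :
    multiGamma 2 (1 + w) = Complex.exp (logBinet 2 w M + M * logBinet 1 w M) *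
      ∏ i ∈ Finset.range M, ((1 + w + i)⁻¹) ^ (i + 1) := by
  rw [multiGamma_two_eq_prod _ M, multiGamma_eq_multiGammaBinet 2 w M hw,
    multiGamma_eq_multiGammaBinet 1 w M hw, Complex.exp_add, Complex.exp_nat_mul]
  rfl

theorem multiGamma_three_one_add {w : ℂ} {M : ℕ} (hw : -((M : ℝ) + 1) < w.re) :
    multiGamma 3 (1 + w) = Complex.exp (logBinet 3 w M + M * logBinet 2 w M +
        ((M + 1).choose 2 : ℕ) * logBinet 1 w M) *
      ∏ i ∈ Finset.range M, ((1 + w + i)⁻¹) ^ ((i + 2).choose 2) := by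
  rw [multiGamma_three_eq_prod _ M, multiGamma_eq_multiGammaBinet 3 w M hw,
    multiGamma_eq_multiGammaBinet 2 w M hw,
    multiGamma_eq_multiGammaBinet 1 w M hw, Complex.exp_add, Complex.exp_add, Complex.exp_nat_mul,
    Complex.exp_nat_mul]
  rfl

/-- The quotient of values of `G` and `Γ_3`. -/
noncomputable def gammaQuotient (x : ℂ) : ℂ :=
  (barnesG (1 + x) * barnesG (1 - x)) ^ 4 *
    (multiGamma 3 (1 - x) * multiGamma 3 (1 + x) /
      (multiGamma 3 (3 / 2 - x) * multiGamma 3 (3 / 2 + x))) ^ 8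

/-- The exponent of `Γ_2 (1 + w)` after `M` factors of its product have been split off. -/
noncomputable def logBinetTwo (w : ℂ) (M : ℕ) : ℂ := logBinet 2 w M + M * logBinet 1 w M

/-- The exponent of `Γ_3 (1 + w)` after `M` factors of its product have been split off. -/
noncomputable def logBinetThree (w : ℂ) (M : ℕ) : ℂ :=
  logBinet 3 w M + M * logBinet 2 w M + ((M + 1).choose 2 : ℕ) * logBinet 1 w M

/-- The exponent of `gammaQuotient x` after `M` factors of its product have been split off. -/
noncomputable def logQuotient (x : ℂ) (M : ℕ) : ℂ :=
  8 * (logBinetThree x M + logBinetThree (-x) M - logBinetThree (1 / 2 + x) M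
    - logBinetThree (1 / 2 - x) M) - 4 * (logBinetTwo x M + logBinetTwo (-x) M)

theorem gammaQuotient_eq {x : ℂ} {M : ℕ} (h1 : x.re < (M : ℝ) + 1) (h2 : -((M : ℝ) + 1) < x.re)
    (hx : ∀ m : ℕ, 1 + x + m ≠ 0) (hx' : ∀ m : ℕ, 1 + -x + m ≠ 0) :
    gammaQuotient x = Complex.exp (logQuotient x M) * ∏ i ∈ Finset.range M,
      ((((1 + x + i) * (1 + -x + i))⁻¹) ^ (4 * (i + 1) ^ 2) *
        ((3 / 2 + x + i) * (3 / 2 - x + i)) ^ (4 * (i + 1) * (i + 2))) := by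
  -- The factors 3/2 ± x + i may vanish, but they enter only through double inverses, harmless when
  -- 0⁻¹ = 0. Only 1 ± x + i must be nonzero.
  have hz : ∀ i : ℕ, ((((1 + x + i) * (1 + -x + i))⁻¹) ^ (4 * (i + 1) ^ 2) *
        ((3 / 2 + x + i) * (3 / 2 - x + i)) ^ (4 * (i + 1) * (i + 2)) : ℂ) =
      ((((1 + x + i)⁻¹) ^ (i + 1))⁻¹ * (((1 + -x + i)⁻¹) ^ (i + 1))⁻¹) ^ 4 *
      (((1 + -x + i)⁻¹) ^ ((i + 2).choose 2) * ((1 + x + i)⁻¹) ^ ((i + 2).choose 2) *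
      ((((1 + (1 / 2 - x) + i)⁻¹) ^ ((i + 2).choose 2))⁻¹ *
        (((1 + (1 / 2 + x) + i)⁻¹) ^ ((i + 2).choose 2))⁻¹)) ^ 8 := by
    intro i
    have ha := hx i
    have hb := hx' i
    rw [show 1 + (1 / 2 - x) + (i : ℂ) = 3 / 2 - x + i by ring,
      show 1 + (1 / 2 + x) + (i : ℂ) = 3 / 2 + x + i by ring]
    generalize 1 + x + (i : ℂ) = a at *
    generalize 1 + -x + (i : ℂ) = b at *
    generalize 3 / 2 - x + (i : ℂ) = c
    generalize 3 / 2 + x + (i : ℂ) = d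
    have hc : 2 * (i + 2).choose 2 = (i + 1) * (i + 2) := by
      rw [Nat.choose_two_right, mul_comm, Nat.div_mul_cancel (Nat.even_mul_pred_self _).two_dvd]
      simp [mul_comm]
    have e1 : 4 * (i + 1) * (i + 2) = (i + 2).choose 2 * 8 := by
      rw [mul_assoc, ← hc]; ring
    have e2 : (i + 2).choose 2 * 8 = 4 * (i + 1) ^ 2 + (i + 1) * 4 := by
      rw [← e1]; ring
    rw [e1]
    simp only [mul_pow, inv_pow, inv_inv, ← pow_mul, mul_inv]
    rw [e2, pow_add a, pow_add b]
    field_simp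
  simp only [hz, Finset.prod_mul_distrib, Finset.prod_pow, Finset.prod_inv_distrib]
  rw [gammaQuotient, barnesG, barnesG, sub_eq_add_neg 1 x, show (3 / 2 - x) = 1 + (1 / 2 - x) by ring,
    show (3 / 2 + x) = 1 + (1 / 2 + x) by ring, multiGamma_two_one_add h2,
    multiGamma_two_one_add (w := -x) (M := M) (by simp; linarith), multiGamma_three_one_add h2,
    multiGamma_three_one_add (w := -x) (M := M) (by simp; linarith),
    multiGamma_three_one_add (w := 1 / 2 + x) (M := M) (by simp; linarith),
    multiGamma_three_one_add (w := 1 / 2 - x) (M := M) (by simp; linarith)]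
  have hq : Complex.exp (logQuotient x M) =
      ((Complex.exp (logBinetTwo x M))⁻¹ * (Complex.exp (logBinetTwo (-x) M))⁻¹) ^ 4 *
      (Complex.exp (logBinetThree (-x) M) * Complex.exp (logBinetThree x M) *
      ((Complex.exp (logBinetThree (1 / 2 - x) M))⁻¹ *
        (Complex.exp (logBinetThree (1 / 2 + x) M))⁻¹)) ^ 8 := by
    simp only [← Complex.exp_neg, ← Complex.exp_add, ← Complex.exp_nat_mul]
    congr 1
    rw [logQuotient]
    push_cast
    ring
  rw [hq]
  simp only [logBinetTwo, logBinetThree, div_eq_mul_inv, mul_inv]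
  ring

/-! ### Cancellation of the Newton parts and the tail integral -/

theorem Complex.choose_two (w : ℂ) : Ring.choose w 2 = w * (w - 1) / 2 := by
  have h := Complex.succ_mul_choose_succ w 1
  rw [Ring.choose_one_right] at h
  norm_num at h
  linear_combination h / 2

theorem Complex.choose_three (w : ℂ) : Ring.choose w 3 = w * (w - 1) * (w - 2) / 6 := by
  have h := Complex.succ_mul_choose_succ w 2
  rw [Complex.choose_two] at h
  norm_num at h
  linear_combination h / 3

/-- The kernel of the integral for the tail of the product. -/
noncomputable def tailKernel (M : ℕ) (t : ℝ) : ℝ :=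
  4 * M * (M + 1) / (1 + Real.exp (-t / 2)) + 4 * M / (1 + Real.exp (-t / 2)) ^ 2 +
    4 / ((1 - Real.exp (-t / 2)) * (1 + Real.exp (-t / 2)) ^ 3)

/-- The logarithm of the tail of the product for `gammaQuotient x / gammaQuotient 0`. -/
noncomputable def tailIntegral (x : ℂ) (M : ℕ) : ℂ :=
  ∫ t in Ioi (0 : ℝ), Real.exp (-((M : ℝ) + 1) * t) *
    ((2 * Complex.cosh (x * t) - 2) / t * tailKernel M t)

/-- After symmetrization in x only x² terms can survive. Those of C(w,2) cancel between the centres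
0 and 1/2 in the Γ_3 part; that of C(w,3), multiplying log Γ_0, cancels against C(w,2) from the Γ_2
part. This fixes the ratio 8 : 4. -/
theorem logNewton_quotient (x : ℂ) (M : ℕ) :
    (8 * ((logNewton 3 x M + M * logNewton 2 x M + M * (M + 1) / 2 * logNewton 1 x M) +
      (logNewton 3 (-x) M + M * logNewton 2 (-x) M + M * (M + 1) / 2 * logNewton 1 (-x) M) -
      (logNewton 3 (1 / 2 + x) M + M * logNewton 2 (1 / 2 + x) M +
        M * (M + 1) / 2 * logNewton 1 (1 / 2 + x) M) -
      (logNewton 3 (1 / 2 - x) M + M * logNewton 2 (1 / 2 - x) M +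
        M * (M + 1) / 2 * logNewton 1 (1 / 2 - x) M)) -
      4 * ((logNewton 2 x M + M * logNewton 1 x M) + (logNewton 2 (-x) M + M * logNewton 1 (-x) M)) : ℂ) =
    (8 * (2 * (logNewton 3 0 M + M * logNewton 2 0 M + M * (M + 1) / 2 * logNewton 1 0 M) -
      2 * (logNewton 3 (1 / 2) M + M * logNewton 2 (1 / 2) M +
        M * (M + 1) / 2 * logNewton 1 (1 / 2) M)) -
      4 * (2 * (logNewton 2 0 M + M * logNewton 1 0 M))) := by
  simp only [logNewton, Finset.sum_range_succ, Finset.sum_range_zero, Ring.choose_zero_right,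
    Ring.choose_one_right, Complex.choose_two, Complex.choose_three, Nat.sub_self, Nat.sub_zero,
    Nat.reduceSub, Nat.reduceAdd]
  ring

theorem integral_lincomb {a b c d e f g : ℝ → ℂ} {μ : Measure ℝ} (ha : Integrable a μ)
    (hb : Integrable b μ) (hc : Integrable c μ) (hd : Integrable d μ) (he : Integrable e μ)
    (hf : Integrable f μ) (hg : Integrable g μ) :
    8 * ((∫ t, a t ∂μ) + (∫ t, b t ∂μ) - (∫ t, c t ∂μ) - (∫ t, d t ∂μ) + 2 * ∫ t, e t ∂μ) -
      4 * ((∫ t, f t ∂μ) + ∫ t, g t ∂μ) =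
    ∫ t, (8 * (a t + b t - c t - d t + 2 * e t) - 4 * (f t + g t)) ∂μ := by
  have hab := ha.fun_add hb
  have habc := Integrable.sub' hab hc
  have habcd := Integrable.sub' habc hd
  have habcde := Integrable.fun_add habcd (he.const_mul 2)
  rw [integral_sub (habcde.const_mul 8) (Integrable.const_mul (hf.fun_add hg) 4),
    integral_const_mul, integral_const_mul, integral_add habcd (he.const_mul 2),
    integral_sub habc hd, integral_sub hab hc, integral_add ha hb, integral_add hf hg,
    integral_const_mul]

/-- The integrand, up to an exponential factor, of the integral part of `logBinetTwo`. -/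
noncomputable def binetKernelTwo (M : ℕ) (w : ℂ) (t : ℝ) : ℂ :=
  binetKernel 2 w t + M * binetKernel 1 w t

/-- The integrand, up to an exponential factor, of the integral part of `logBinetThree`. -/
noncomputable def binetKernelThree (M : ℕ) (w : ℂ) (t : ℝ) : ℂ :=
  binetKernel 3 w t + M * binetKernel 2 w t + M * (M + 1) / 2 * binetKernel 1 w t

theorem binetIntegral_two_add {w : ℂ} {M : ℕ} (hw : -((M : ℝ) + 1) < w.re) :
    IntegrableOn (fun t : ℝ => Real.exp (-((M : ℝ) + 1) * t) * binetKernelTwo M w t) (Ioi 0) ∧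
    binetIntegral 2 w (M + 1) + M * binetIntegral 1 w (M + 1) =
      ∫ t in Ioi (0 : ℝ), Real.exp (-((M : ℝ) + 1) * t) * binetKernelTwo M w t := by
  have h := fun n => integrableOn_binetKernel n w (by positivity) hw
  have e : (fun t : ℝ => (Real.exp (-((M : ℝ) + 1) * t) : ℂ) * binetKernelTwo M w t) = fun t : ℝ =>
      (Real.exp (-((M : ℝ) + 1) * t) : ℂ) * binetKernel 2 w t +
      M * ((Real.exp (-((M : ℝ) + 1) * t) : ℂ) * binetKernel 1 w t) := by
    funext t; rw [binetKernelTwo]; ring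
  rw [e]
  refine ⟨Integrable.fun_add (h 2) ((h 1).const_mul _), ?_⟩
  rw [integral_add (h 2) ((h 1).const_mul _), integral_const_mul]
  rfl

theorem binetIntegral_three_add {w : ℂ} {M : ℕ} (hw : -((M : ℝ) + 1) < w.re) :
    IntegrableOn (fun t : ℝ => Real.exp (-((M : ℝ) + 1) * t) * binetKernelThree M w t) (Ioi 0) ∧
    binetIntegral 3 w (M + 1) + M * binetIntegral 2 w (M + 1) +
      M * (M + 1) / 2 * binetIntegral 1 w (M + 1) =
      ∫ t in Ioi (0 : ℝ), Real.exp (-((M : ℝ) + 1) * t) * binetKernelThree M w t := by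
  have h := fun n => integrableOn_binetKernel n w (by positivity) hw
  have e : (fun t : ℝ => (Real.exp (-((M : ℝ) + 1) * t) : ℂ) * binetKernelThree M w t) = fun t : ℝ =>
      (Real.exp (-((M : ℝ) + 1) * t) : ℂ) * binetKernel 3 w t +
      M * ((Real.exp (-((M : ℝ) + 1) * t) : ℂ) * binetKernel 2 w t) +
      M * (M + 1) / 2 * ((Real.exp (-((M : ℝ) + 1) * t) : ℂ) * binetKernel 1 w t) := by
    funext t; rw [binetKernelThree]; ring
  rw [e]
  refine ⟨Integrable.fun_add (Integrable.fun_add (h 3) ((h 2).const_mul _)) ((h 1).const_mul _), ?_⟩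
  rw [integral_add (Integrable.fun_add (h 3) ((h 2).const_mul _)) ((h 1).const_mul _),
    integral_add (h 3) ((h 2).const_mul _), integral_const_mul, integral_const_mul]
  rfl

/-- With p = e^{-t/2}, 1-e^{-t} = (1-p)(1+p) and raising w by 1/2 multiplies e^{-wt} by p, so this
is an identity of rational functions. The kernel at 1/2 subtracts the value at x = 0, where the
remainders at ±x vanish. -/
theorem kernel_quotient (x : ℂ) (M : ℕ) {t : ℝ} (ht : 0 < t) :
    8 * (binetKernelThree M x t + binetKernelThree M (-x) t - binetKernelThree M (1 / 2 + x) t -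
      binetKernelThree M (1 / 2 - x) t + 2 * binetKernelThree M (1 / 2) t) -
      4 * (binetKernelTwo M x t + binetKernelTwo M (-x) t) =
    (2 * Complex.cosh (x * t) - 2) / t * tailKernel M t := by
  have h1 : (t : ℂ) ≠ 0 := by exact_mod_cast (ne_of_gt ht)
  have hp : 0 < 1 - Real.exp (-(t / 2)) := one_sub_exp_neg_pos (by positivity)
  have h2 : ((1 - Real.exp (-(t / 2)) : ℝ) : ℂ) ≠ 0 := by exact_mod_cast hp.ne'
  have h3 : ((1 + Real.exp (-(t / 2)) : ℝ) : ℂ) ≠ 0 := by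
    have := Real.exp_pos (-(t / 2)); exact_mod_cast (by positivity : (1 + Real.exp (-(t / 2))) ≠ 0)
  have h4 : Real.exp (-t) = Real.exp (-(t / 2)) ^ 2 := by
    rw [← Real.exp_nat_mul]; congr 1; push_cast; ring
  have h5 : ∀ v : ℂ, Complex.exp (-(1 / 2 + v) * t) =
      (Real.exp (-(t / 2)) : ℂ) * Complex.exp (-v * t) := by
    intro v
    rw [Complex.ofReal_exp, ← Complex.exp_add]; congr 1; push_cast; ring
  have h6 : Complex.exp (-(1 / 2 : ℂ) * t) = (Real.exp (-(t / 2)) : ℂ) := by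
    rw [Complex.ofReal_exp]; congr 1; push_cast; ring
  have h7 : Complex.cosh (x * t) = (Complex.exp (- -x * t) + Complex.exp (-x * t)) / 2 := by
    rw [Complex.cosh]; simp
  simp only [binetKernelTwo, binetKernelThree, binetKernel, binomRem, Finset.sum_range_succ,
    Finset.sum_range_zero, Ring.choose_zero_right,
    Ring.choose_one_right, Complex.choose_two, Complex.choose_three, tailKernel, h7, h4, h6, h5,
    sub_eq_add_neg (1 / 2) x, neg_div]
  generalize Complex.exp (- -x * t) = X
  generalize Complex.exp (-x * t) = Y
  generalize Real.exp (-(t / 2)) = p at *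
  have h8 : ((1 - p ^ 2 : ℝ) : ℂ) = ((1 - p : ℝ) : ℂ) * ((1 + p : ℝ) : ℂ) := by push_cast; ring
  rw [h8]
  push_cast at h2 h3 ⊢
  field_simp
  ring

theorem logQuotient_sub (x : ℂ) {M : ℕ} (h1 : x.re < (M : ℝ) + 1) (h2 : -((M : ℝ) + 1) < x.re) :
    logQuotient x M = logQuotient 0 M + tailIntegral x M := by
  have hM : (0 : ℝ) ≤ M := M.cast_nonneg
  have a3 := binetIntegral_three_add h2
  have b3 := binetIntegral_three_add (w := -x) (M := M) (by simp; linarith)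
  have c3 := binetIntegral_three_add (w := 1 / 2 + x) (M := M) (by simp; linarith)
  have d3 := binetIntegral_three_add (w := 1 / 2 - x) (M := M) (by simp; linarith)
  have e3 := binetIntegral_three_add (w := 1 / 2) (M := M) (by simp; linarith)
  have f2 := binetIntegral_two_add h2
  have g2 := binetIntegral_two_add (w := -x) (M := M) (by simp; linarith)
  have key := integral_lincomb a3.1 b3.1 c3.1 d3.1 e3.1 f2.1 g2.1
  rw [← a3.2, ← b3.2, ← c3.2, ← d3.2, ← e3.2, ← f2.2, ← g2.2] at key
  have hT : tailIntegral x M = ∫ t in Ioi (0 : ℝ),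
      (8 * ((Real.exp (-((M : ℝ) + 1) * t) : ℂ) * binetKernelThree M x t +
        (Real.exp (-((M : ℝ) + 1) * t) : ℂ) * binetKernelThree M (-x) t -
        (Real.exp (-((M : ℝ) + 1) * t) : ℂ) * binetKernelThree M (1 / 2 + x) t -
        (Real.exp (-((M : ℝ) + 1) * t) : ℂ) * binetKernelThree M (1 / 2 - x) t +
        2 * ((Real.exp (-((M : ℝ) + 1) * t) : ℂ) * binetKernelThree M (1 / 2) t)) -
      4 * ((Real.exp (-((M : ℝ) + 1) * t) : ℂ) * binetKernelTwo M x t +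
        (Real.exp (-((M : ℝ) + 1) * t) : ℂ) * binetKernelTwo M (-x) t)) := by
    refine setIntegral_congr_fun measurableSet_Ioi fun t ht => ?_
    rw [← kernel_quotient x M ht]
    ring
  rw [hT, ← key]
  have hN := logNewton_quotient x M
  have hc : (((M + 1).choose 2 : ℕ) : ℂ) = M * (M + 1) / 2 := by
    rw [Nat.cast_choose_two]; push_cast; ring
  simp only [logQuotient, logBinetThree, logBinetTwo, logBinet, hc, neg_zero, add_zero, sub_zero,
    binetIntegral_zero_mid]
  linear_combination hN

/-- The normalized finite product that is compared with `gammaQuotient`. -/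
noncomputable def headProd (x : ℂ) (M : ℕ) : ℂ :=
  ∏ i ∈ Finset.range M, (((1 - x ^ 2 / ((i : ℂ) + 1) ^ 2)⁻¹) ^ (4 * (i + 1) ^ 2) *
    (1 - 4 * x ^ 2 / (2 * (i : ℂ) + 3) ^ 2) ^ (4 * (i + 1) * (i + 2)))

theorem gammaQuotient_eq_headProd {x : ℂ} {M : ℕ} (h1 : x.re < (M : ℝ) + 1)
    (h2 : -((M : ℝ) + 1) < x.re) (hx : ∀ m : ℕ, 1 + x + m ≠ 0) (hx' : ∀ m : ℕ, 1 + -x + m ≠ 0) :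
    gammaQuotient x = gammaQuotient 0 * headProd x M * Complex.exp (tailIntegral x M) := by
  have h0 : ∀ m : ℕ, (1 : ℂ) + m ≠ 0 := fun m => by
    rw [add_comm]; exact_mod_cast m.succ_ne_zero
  rw [gammaQuotient_eq h1 h2 hx hx', gammaQuotient_eq (x := 0) (M := M) (by simp; positivity)
    (by simp; linarith [M.cast_nonneg (α := ℝ)]) (by simpa using h0) (by simpa using h0),
    logQuotient_sub x h1 h2, Complex.exp_add, headProd]
  have : ∀ i : ℕ, ((((1 + x + i) * (1 + -x + i))⁻¹) ^ (4 * (i + 1) ^ 2) *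
        ((3 / 2 + x + i) * (3 / 2 - x + i)) ^ (4 * (i + 1) * (i + 2)) : ℂ) =
      ((((1 + 0 + i) * (1 + -(0 : ℂ) + i))⁻¹) ^ (4 * (i + 1) ^ 2) *
        ((3 / 2 + 0 + i) * (3 / 2 - 0 + i)) ^ (4 * (i + 1) * (i + 2)) : ℂ) *
      ((((1 - x ^ 2 / ((i : ℂ) + 1) ^ 2)⁻¹) ^ (4 * (i + 1) ^ 2) *
      (1 - 4 * x ^ 2 / (2 * (i : ℂ) + 3) ^ 2) ^ (4 * (i + 1) * (i + 2)))) := by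
    intro i
    have e1 : (1 + x + (i : ℂ)) * (1 + -x + i) =
        ((1 + 0 + i) * (1 + -(0 : ℂ) + i)) * (1 - x ^ 2 / ((i : ℂ) + 1) ^ 2) := by
      have := h0 i
      rw [add_comm] at this
      field_simp
      ring
    have e2 : (3 / 2 + x + (i : ℂ)) * (3 / 2 - x + i) =
        ((3 / 2 + 0 + i) * (3 / 2 - 0 + i)) * (1 - 4 * x ^ 2 / (2 * (i : ℂ) + 3) ^ 2) := by
      have : (2 * (i : ℂ) + 3) ≠ 0 := by exact_mod_cast (by omega : 2 * i + 3 ≠ 0)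
      field_simp
      ring
    rw [e1, e2, mul_inv, mul_pow, mul_pow]
    ring
  rw [Finset.prod_congr rfl fun i _ => this i, Finset.prod_mul_distrib]
  ac_rfl

/-! ### Laplace estimates and the limit of the tail -/

theorem integral_pow_mul_exp_neg (k : ℕ) {r : ℝ} (hr : 0 < r) :
    IntegrableOn (fun t : ℝ => t ^ k * Real.exp (-r * t)) (Ioi 0) ∧
      ∫ t in Ioi (0 : ℝ), t ^ k * Real.exp (-r * t) = k.factorial / r ^ (k + 1) := by
  constructor
  · have h := integrableOn_rpow_mul_exp_neg_mul_rpow (s := k) (p := 1) (b := r)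
      (by have := k.cast_nonneg (α := ℝ); linarith) one_pos hr
    simpa using h
  · have h := Real.integral_rpow_mul_exp_neg_mul_Ioi (a := k + 1) (r := r) (by positivity) hr
    rw [Real.Gamma_nat_eq_factorial] at h
    simp only [add_sub_cancel_right, Real.rpow_natCast] at h
    simp only [neg_mul]
    rw [h, show ((k : ℝ) + 1) = ((k + 1 : ℕ) : ℝ) by push_cast; ring, Real.rpow_natCast]
    rw [one_div, inv_pow]
    field_simp

theorem exp_laplace_bound {f : ℝ → ℂ} (hf : ContinuousOn f (Ioi 0)) {C a N : ℝ} {k : ℕ}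
    (hb : ∀ t, 0 < t → ‖f t‖ ≤ C * (t ^ k * Real.exp (a * t))) (hN : a < N) :
    IntegrableOn (fun t : ℝ => Real.exp (-N * t) * f t) (Ioi 0) ∧
      ‖∫ t in Ioi (0 : ℝ), Real.exp (-N * t) * f t‖ ≤ C * (k.factorial / (N - a) ^ (k + 1)) := by
  have h := integral_pow_mul_exp_neg k (sub_pos.2 hN)
  have hle : ∀ᵐ t ∂(volume.restrict (Ioi (0 : ℝ))), ‖(Real.exp (-N * t) : ℂ) * f t‖ ≤
      C * (t ^ k * Real.exp (-(N - a) * t)) := by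
    filter_upwards [ae_restrict_mem measurableSet_Ioi] with t ht
    rw [norm_mul, Complex.norm_real, Real.norm_of_nonneg (Real.exp_pos _).le]
    calc Real.exp (-N * t) * ‖f t‖ ≤ Real.exp (-N * t) * (C * (t ^ k * Real.exp (a * t))) := by
          gcongr; exact hb t ht
      _ = C * (t ^ k * (Real.exp (-N * t) * Real.exp (a * t))) := by ring
      _ = _ := by rw [← Real.exp_add]; ring_nf
  refine ⟨Integrable.mono' (h.1.const_mul C)
    (ContinuousOn.aestronglyMeasurable (by fun_prop) measurableSet_Ioi) hle, ?_⟩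
  refine (norm_integral_le_of_norm_le (h.1.const_mul C) hle).trans_eq ?_
  rw [integral_const_mul, h.2]

theorem Complex.norm_two_mul_cosh_sub_two_le (y : ℂ) :
    ‖2 * Complex.cosh y - 2‖ ≤ 2 * ‖y‖ ^ 2 * Real.exp ‖y‖ := by
  have h1 := Complex.norm_exp_sub_sum_le_norm_mul_exp y 2
  have h2 := Complex.norm_exp_sub_sum_le_norm_mul_exp (-y) 2
  have e : 2 * Complex.cosh y - 2 = (Complex.exp y - ∑ m ∈ Finset.range 2, y ^ m / m.factorial) +
      (Complex.exp (-y) - ∑ m ∈ Finset.range 2, (-y) ^ m / m.factorial) := by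
    simp [Complex.cosh, Finset.sum_range_succ]; ring
  rw [e]
  rw [norm_neg] at h2
  linarith [norm_add_le (Complex.exp y - ∑ m ∈ Finset.range 2, y ^ m / m.factorial)
    (Complex.exp (-y) - ∑ m ∈ Finset.range 2, (-y) ^ m / m.factorial)]

theorem Complex.norm_two_mul_cosh_sub_le (y : ℂ) :
    ‖2 * Complex.cosh y - 2 - y ^ 2‖ ≤ 2 * ‖y‖ ^ 3 * Real.exp ‖y‖ := by
  have h1 := Complex.norm_exp_sub_sum_le_norm_mul_exp y 3
  have h2 := Complex.norm_exp_sub_sum_le_norm_mul_exp (-y) 3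
  have e : 2 * Complex.cosh y - 2 - y ^ 2 =
      (Complex.exp y - ∑ m ∈ Finset.range 3, y ^ m / m.factorial) +
      (Complex.exp (-y) - ∑ m ∈ Finset.range 3, (-y) ^ m / m.factorial) := by
    simp [Complex.cosh, Finset.sum_range_succ]; ring
  rw [e]
  rw [norm_neg] at h2
  linarith [norm_add_le (Complex.exp y - ∑ m ∈ Finset.range 3, y ^ m / m.factorial)
    (Complex.exp (-y) - ∑ m ∈ Finset.range 3, (-y) ^ m / m.factorial)]

theorem norm_cosh_kernel_le (x : ℂ) {t : ℝ} (ht : 0 < t) :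
    ‖(2 * Complex.cosh (x * t) - 2) / t‖ ≤ 2 * ‖x‖ ^ 2 * (t * Real.exp (‖x‖ * t)) := by
  have h := Complex.norm_two_mul_cosh_sub_two_le (x * t)
  rw [norm_mul, Complex.norm_real, Real.norm_of_nonneg ht.le] at h
  rw [norm_div, Complex.norm_real, Real.norm_of_nonneg ht.le, div_le_iff₀ ht]
  exact h.trans_eq (by ring)

theorem norm_cosh_kernel_sub_le (x : ℂ) {t : ℝ} (ht : 0 < t) :
    ‖(2 * Complex.cosh (x * t) - 2) / t - x ^ 2 * t‖ ≤
      2 * ‖x‖ ^ 3 * (t ^ 2 * Real.exp (‖x‖ * t)) := by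
  have h := Complex.norm_two_mul_cosh_sub_le (x * t)
  have h1 : (t : ℂ) ≠ 0 := by exact_mod_cast (ne_of_gt ht)
  rw [norm_mul, Complex.norm_real, Real.norm_of_nonneg ht.le] at h
  rw [show (2 * Complex.cosh (x * t) - 2) / t - x ^ 2 * t =
    (2 * Complex.cosh (x * t) - 2 - (x * t) ^ 2) / t by field_simp,
    norm_div, Complex.norm_real, Real.norm_of_nonneg ht.le, div_le_iff₀ ht]
  exact h.trans_eq (by ring)

/-- Near t = 0 the cosh factor is about x²t and 1/(1+e^{-t/2}) about 1/2, so the M(M+1) term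
contributes 4M(M+1)·(x²/2)/(M+1)², which tends to 2x². All else is O(1/M). -/
theorem tendsto_tailIntegral (x : ℂ) :
    Tendsto (fun M : ℕ => tailIntegral x M) atTop (𝓝 (2 * x ^ 2)) := by
  set a := ‖x‖ with ha
  have ha0 : 0 ≤ a := norm_nonneg _
  set c : ℝ → ℂ := fun t => (2 * Complex.cosh (x * t) - 2) / t with hc
  -- The main term is subtracted, leaving O(t²) at 0: its integral O(M⁻³) beats the weight 4M(M+1).
  -- Likewise f₂ gives O(M⁻²) against 4M and f₃ gives O(M⁻¹) against 4.
  set f₁ : ℝ → ℂ := fun t => c t * ((1 / (1 + Real.exp (-t / 2)) : ℝ) : ℂ) - x ^ 2 / 2 * t with hf₁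
  set f₂ : ℝ → ℂ := fun t => c t * ((1 / (1 + Real.exp (-t / 2)) ^ 2 : ℝ) : ℂ) with hf₂
  set f₃ : ℝ → ℂ := fun t =>
    c t * ((1 / ((1 - Real.exp (-t / 2)) * (1 + Real.exp (-t / 2)) ^ 3) : ℝ) : ℂ) with hf₃
  have hcc : ContinuousOn c (Ioi 0) := by
    refine ContinuousOn.div (by fun_prop) (by fun_prop) fun t ht => ?_
    exact_mod_cast (ne_of_gt ht)
  have hpos : ∀ t : ℝ, 0 < 1 + Real.exp (-t / 2) := fun t => by positivity
  have hpos' : ∀ t : ℝ, 0 < t → t / (2 + t) ≤ 1 - Real.exp (-t / 2) := fun t ht => by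
    have h2 : t / 2 + 1 ≤ Real.exp (t / 2) := Real.add_one_le_exp _
    rw [neg_div, Real.exp_neg]
    have h3 : (Real.exp (t / 2))⁻¹ ≤ (t / 2 + 1)⁻¹ := inv_anti₀ (by linarith) h2
    have h4 : t / (2 + t) = 1 - (t / 2 + 1)⁻¹ := by
      field_simp; ring
    linarith
  have hpos'' : ∀ t : ℝ, 0 < t → 0 < 1 - Real.exp (-t / 2) := fun t ht =>
    lt_of_lt_of_le (by positivity) (hpos' t ht)
  have hcont₁ : ContinuousOn f₁ (Ioi 0) := by
    have : Continuous fun t : ℝ => 1 / (1 + Real.exp (-t / 2)) :=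
      continuous_const.div (by fun_prop) fun t => (hpos t).ne'
    exact (hcc.mul (Complex.continuous_ofReal.comp this).continuousOn).sub (by fun_prop)
  have hcont₂ : ContinuousOn f₂ (Ioi 0) := by
    have : Continuous fun t : ℝ => 1 / (1 + Real.exp (-t / 2)) ^ 2 :=
      continuous_const.div (by fun_prop) fun t => pow_ne_zero _ (hpos t).ne'
    exact hcc.mul (Complex.continuous_ofReal.comp this).continuousOn
  have hcont₃ : ContinuousOn f₃ (Ioi 0) := by
    have : ContinuousOn (fun t : ℝ => 1 / ((1 - Real.exp (-t / 2)) * (1 + Real.exp (-t / 2)) ^ 3))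
        (Ioi 0) :=
      continuousOn_const.div (by fun_prop) fun t ht =>
        mul_ne_zero (hpos'' t ht).ne' (pow_ne_zero _ (hpos t).ne')
    exact hcc.mul (Complex.continuous_ofReal.comp_continuousOn this)
  have hb₁ : ∀ t, 0 < t → ‖f₁ t‖ ≤ (2 * a ^ 3 + a ^ 2) * (t ^ 2 * Real.exp (a * t)) := by
    intro t ht
    have hsplit : f₁ t = (c t - x ^ 2 * t) * ((1 / (1 + Real.exp (-t / 2)) : ℝ) : ℂ) +
        x ^ 2 * t * ((1 / (1 + Real.exp (-t / 2)) - 1 / 2 : ℝ) : ℂ) := by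
      simp only [hf₁]; push_cast; ring
    have h1 : |1 / (1 + Real.exp (-t / 2))| ≤ 1 := by
      rw [abs_of_pos (by have := hpos t; positivity), div_le_one (hpos t)]
      linarith [Real.exp_pos (-t / 2)]
    have h2 : |1 / (1 + Real.exp (-t / 2)) - 1 / 2| ≤ t := by
      have h3 := Real.add_one_le_exp (-t / 2)
      have h4 := hpos'' t ht
      rw [show 1 / (1 + Real.exp (-t / 2)) - 1 / 2 =
        (1 - Real.exp (-t / 2)) / (2 * (1 + Real.exp (-t / 2))) by
          have := hpos t; field_simp; ring, abs_of_pos (by have := hpos t; positivity),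
        div_le_iff₀ (by have := hpos t; positivity)]
      nlinarith [Real.exp_pos (-t / 2)]
    have h5 := norm_cosh_kernel_sub_le x ht
    rw [hsplit]
    refine (norm_add_le _ _).trans ?_
    rw [norm_mul, norm_mul _ (((1 / (1 + Real.exp (-t / 2)) - 1 / 2 : ℝ)) : ℂ), norm_mul, norm_pow,
      Complex.norm_real, Complex.norm_real, Complex.norm_real, Real.norm_of_nonneg ht.le,
      Real.norm_eq_abs, Real.norm_eq_abs]
    have h6 : 1 ≤ Real.exp (a * t) := Real.one_le_exp (by positivity)
    calc _ ≤ 2 * a ^ 3 * (t ^ 2 * Real.exp (a * t)) * 1 + a ^ 2 * t * t := by gcongr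
      _ ≤ 2 * a ^ 3 * (t ^ 2 * Real.exp (a * t)) * 1 + a ^ 2 * t * t * Real.exp (a * t) := by
        have := le_mul_of_one_le_right (by positivity : 0 ≤ a ^ 2 * t * t) h6
        linarith
      _ = _ := by ring
  have hb₂ : ∀ t, 0 < t → ‖f₂ t‖ ≤ (2 * a ^ 2) * (t ^ 1 * Real.exp (a * t)) := by
    intro t ht
    have h1 : |1 / (1 + Real.exp (-t / 2)) ^ 2| ≤ 1 := by
      rw [abs_of_pos (by have := hpos t; positivity), div_le_one (pow_pos (hpos t) _)]
      exact one_le_pow₀ (by linarith [Real.exp_pos (-t / 2)])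
    simp only [hf₂]
    rw [norm_mul, Complex.norm_real, Real.norm_eq_abs, pow_one]
    exact (mul_le_of_le_one_right (norm_nonneg _) h1).trans (norm_cosh_kernel_le x ht)
  -- The pole of 1/(1-e^{-t/2}) costs one power of t, and the growth 2+t ≤ 2e^t raises the rate to
  -- a+1.
  have hb₃ : ∀ t, 0 < t → ‖f₃ t‖ ≤ (4 * a ^ 2) * (t ^ 0 * Real.exp ((a + 1) * t)) := by
    intro t ht
    have h1 : |1 / ((1 - Real.exp (-t / 2)) * (1 + Real.exp (-t / 2)) ^ 3)| ≤ (2 + t) / t := by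
      have h3 := hpos'' t ht
      rw [abs_of_pos (by have := hpos t; positivity), ← one_div_div t]
      apply one_div_le_one_div_of_le (by positivity)
      refine (hpos' t ht).trans (le_mul_of_one_le_right h3.le (one_le_pow₀ ?_))
      linarith [Real.exp_pos (-t / 2)]
    simp only [hf₃]
    rw [norm_mul, Complex.norm_real, Real.norm_eq_abs, pow_zero, one_mul]
    have h4 : (2 + t) ≤ 2 * Real.exp t := by linarith [Real.add_one_le_exp t]
    calc _ ≤ 2 * a ^ 2 * (t * Real.exp (a * t)) * ((2 + t) / t) := by
          gcongr; exact norm_cosh_kernel_le x ht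
      _ = 2 * a ^ 2 * Real.exp (a * t) * (2 + t) := by field_simp
      _ ≤ 2 * a ^ 2 * Real.exp (a * t) * (2 * Real.exp t) := by gcongr
      _ = _ := by rw [add_mul, Real.exp_add, one_mul]; ring
  set J₁ : ℕ → ℂ := fun M => ∫ t in Ioi (0 : ℝ), Real.exp (-((M : ℝ) + 1) * t) * f₁ t with hJ₁
  set J₂ : ℕ → ℂ := fun M => ∫ t in Ioi (0 : ℝ), Real.exp (-((M : ℝ) + 1) * t) * f₂ t with hJ₂
  set J₃ : ℕ → ℂ := fun M => ∫ t in Ioi (0 : ℝ), Real.exp (-((M : ℝ) + 1) * t) * f₃ t with hJ₃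
  have hMa : ∀ b : ℝ, Tendsto (fun M : ℕ => (M : ℝ) + 1 - b) atTop atTop := fun b =>
    tendsto_atTop_add_const_right _ _
      (tendsto_atTop_add_const_right _ _ tendsto_natCast_atTop_atTop)
  have hMb : ∀ b : ℝ, Tendsto (fun M : ℕ => ((M : ℝ) + 1) / ((M : ℝ) + 1 - b)) atTop (𝓝 1) := by
    intro b
    have h := (tendsto_const_nhds (x := b)).div_atTop (hMa b)
    have h2 := h.const_add 1
    rw [add_zero] at h2
    refine h2.congr' ?_
    filter_upwards [(hMa b).eventually_gt_atTop 0] with M hM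
    field_simp
    ring
  have hlim₁ : Tendsto (fun M : ℕ => 4 * (M : ℂ) * (M + 1) * J₁ M) atTop (𝓝 0) := by
    have h : Tendsto (fun M : ℕ => 8 * (2 * a ^ 3 + a ^ 2) * (((M : ℝ) + 1) / ((M : ℝ) + 1 - a)) ^ 2 *
        (1 / ((M : ℝ) + 1 - a))) atTop (𝓝 0) := by
      have := (((hMb a).pow 2).const_mul (8 * (2 * a ^ 3 + a ^ 2))).mul
        ((tendsto_const_nhds (x := (1 : ℝ))).div_atTop (hMa a))
      simpa using this
    refine squeeze_zero_norm' ?_ h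
    filter_upwards [(hMa a).eventually_gt_atTop 0] with M hM
    have hj := (exp_laplace_bound hcont₁ hb₁ (N := (M : ℝ) + 1) (by linarith)).2
    rw [norm_mul, norm_mul, norm_mul, RCLike.norm_ofNat, Complex.norm_natCast,
      show ((M : ℂ) + 1) = ((M + 1 : ℕ) : ℂ) by push_cast; ring, Complex.norm_natCast]
    push_cast
    calc _ ≤ 4 * ((M : ℝ) + 1) * (M + 1) *
          ((2 * a ^ 3 + a ^ 2) * (Nat.factorial 2 / ((M : ℝ) + 1 - a) ^ (2 + 1))) := by
          gcongr; linarith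
      _ = _ := by
        simp only [Nat.factorial_two, Nat.cast_ofNat]
        field_simp
        ring
  have hlim₂ : Tendsto (fun M : ℕ => 4 * (M : ℂ) * J₂ M) atTop (𝓝 0) := by
    have h : Tendsto (fun M : ℕ => 4 * (2 * a ^ 2) * (((M : ℝ) + 1) / ((M : ℝ) + 1 - a)) *
        (1 / ((M : ℝ) + 1 - a))) atTop (𝓝 0) := by
      have := ((hMb a).const_mul (4 * (2 * a ^ 2))).mul
        ((tendsto_const_nhds (x := (1 : ℝ))).div_atTop (hMa a))
      simpa using this
    refine squeeze_zero_norm' ?_ h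
    filter_upwards [(hMa a).eventually_gt_atTop 0] with M hM
    have hj := (exp_laplace_bound hcont₂ hb₂ (N := (M : ℝ) + 1) (by linarith)).2
    rw [norm_mul, norm_mul, RCLike.norm_ofNat, Complex.norm_natCast]
    calc _ ≤ 4 * ((M : ℝ) + 1) *
          ((2 * a ^ 2) * (Nat.factorial 1 / ((M : ℝ) + 1 - a) ^ (1 + 1))) := by
          gcongr; linarith
      _ = _ := by
        simp only [Nat.factorial_one, Nat.cast_one]
        field_simp
  have hlim₃ : Tendsto (fun M : ℕ => 4 * J₃ M) atTop (𝓝 0) := by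
    have h : Tendsto (fun M : ℕ => 4 * (4 * a ^ 2) * (1 / ((M : ℝ) + 1 - (a + 1)))) atTop (𝓝 0) := by
      have := ((tendsto_const_nhds (x := (1 : ℝ))).div_atTop (hMa (a + 1))).const_mul
        (4 * (4 * a ^ 2))
      simpa using this
    refine squeeze_zero_norm' ?_ h
    filter_upwards [(hMa (a + 1)).eventually_gt_atTop 0] with M hM
    have hj := (exp_laplace_bound hcont₃ hb₃ (N := (M : ℝ) + 1) (by linarith)).2
    rw [norm_mul, RCLike.norm_ofNat]
    calc _ ≤ 4 * ((4 * a ^ 2) * (Nat.factorial 0 / ((M : ℝ) + 1 - (a + 1)) ^ (0 + 1))) := by gcongr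
      _ = _ := by simp; ring
  have hlim₀ : Tendsto (fun M : ℕ => 2 * x ^ 2 * ((M : ℂ) / (M + 1))) atTop (𝓝 (2 * x ^ 2)) := by
    simpa using (tendsto_natCast_div_add_atTop (1 : ℂ)).const_mul (2 * x ^ 2)
  have := ((hlim₀.add hlim₁).add hlim₂).add hlim₃
  simp only [add_zero] at this
  refine this.congr' ?_
  filter_upwards [(hMa (a + 1)).eventually_gt_atTop 0] with M hM
  have i₁ := (exp_laplace_bound hcont₁ hb₁ (N := (M : ℝ) + 1) (by linarith)).1
  have i₂ := (exp_laplace_bound hcont₂ hb₂ (N := (M : ℝ) + 1) (by linarith)).1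
  have i₃ := (exp_laplace_bound hcont₃ hb₃ (N := (M : ℝ) + 1) (by linarith)).1
  have h0 := integral_pow_mul_exp_neg 1 (r := (M : ℝ) + 1) (by positivity)
  have i₀ : IntegrableOn (fun t : ℝ => ((t ^ 1 * Real.exp (-((M : ℝ) + 1) * t) : ℝ) : ℂ)) (Ioi 0) :=
    h0.1.ofReal
  have h0' : ∫ t in Ioi (0 : ℝ), ((t ^ 1 * Real.exp (-((M : ℝ) + 1) * t) : ℝ) : ℂ) =
      1 / ((M : ℂ) + 1) ^ 2 := by
    rw [integral_complex_ofReal, h0.2]; simp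
  have hM1 : ((M : ℂ) + 1) ≠ 0 := by exact_mod_cast M.succ_ne_zero
  have e0 : 2 * x ^ 2 * ((M : ℂ) / (M + 1)) = 2 * x ^ 2 * M * (M + 1) *
      ∫ t in Ioi (0 : ℝ), ((t ^ 1 * Real.exp (-((M : ℝ) + 1) * t) : ℝ) : ℂ) := by
    rw [h0']; field_simp
  have s₁ := Integrable.fun_add (i₀.const_mul (2 * x ^ 2 * M * (M + 1)))
    (i₁.const_mul (4 * (M : ℂ) * (M + 1)))
  have s₂ := Integrable.fun_add s₁ (i₂.const_mul (4 * (M : ℂ)))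
  rw [e0, hJ₁, hJ₂, hJ₃, ← integral_const_mul, ← integral_const_mul, ← integral_const_mul,
    ← integral_const_mul, ← integral_add (i₀.const_mul _) (i₁.const_mul _),
    ← integral_add s₁ (i₂.const_mul _), ← integral_add s₂ (i₃.const_mul _), tailIntegral]
  refine setIntegral_congr_fun measurableSet_Ioi fun t _ => ?_
  simp only [hf₁, hf₂, hf₃, hc, tailKernel]
  push_cast
  ring

/-! ### A Mellin transform at 0 and ζ(3) -/

/-- The generating function `∑ (-1)^(k-1) k^2 e^{-kt}`. -/
noncomputable def altSquareGen (t : ℝ) : ℂ :=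
  ((Real.exp (-t) * (1 - Real.exp (-t)) / (1 + Real.exp (-t)) ^ 3 : ℝ) : ℂ)

theorem hasSum_altSquareGen {t : ℝ} (ht : 0 < t) :
    HasSum (fun i : ℕ => ((-1) ^ i * ((i : ℂ) + 1) ^ 2) * (Real.exp (-((i : ℝ) + 1) * t) : ℂ))
      (altSquareGen t) := by
  have hE : Real.exp (-t) < 1 := Real.exp_lt_one_iff.mpr (by linarith)
  have hn : ‖-(Real.exp (-t) : ℂ)‖ < 1 := by
    rwa [norm_neg, Complex.norm_real, Real.norm_of_nonneg (Real.exp_pos _).le]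
  -- Uses 2 C(i+2,2) - C(i+1,1) = (i+1)².
  have h1 := (hasSum_choose_mul_geometric_of_norm_lt_one 2 hn).mul_left 2
  have h2 := hasSum_choose_mul_geometric_of_norm_lt_one 1 hn
  have h3 := (h1.sub h2).mul_left (Real.exp (-t) : ℂ)
  have hne : (1 + (Real.exp (-t) : ℂ)) ≠ 0 := by
    have := Real.exp_pos (-t)
    exact_mod_cast (by positivity : 1 + Real.exp (-t) ≠ 0)
  have hv : (Real.exp (-t) : ℂ) * (2 * (1 / (1 - -(Real.exp (-t) : ℂ)) ^ (2 + 1)) -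
      1 / (1 - -(Real.exp (-t) : ℂ)) ^ (1 + 1)) = altSquareGen t := by
    rw [altSquareGen, sub_neg_eq_add]
    push_cast at hne ⊢
    field_simp
    ring
  rw [hv] at h3
  refine h3.congr_fun fun i => ?_
  have e : (Real.exp (-((i : ℝ) + 1) * t) : ℂ) = (Real.exp (-t) : ℂ) ^ (i + 1) := by
    rw [← Complex.ofReal_pow, ← Real.exp_nat_mul]; congr 2; push_cast; ring
  rw [e, Nat.choose_one_right, Nat.cast_choose_two, neg_pow (Real.exp (-t) : ℂ) i]
  push_cast
  ring

theorem continuous_altSquareGen : Continuous altSquareGen := by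
  unfold altSquareGen
  refine Complex.continuous_ofReal.comp (Continuous.div (by fun_prop) (by fun_prop) fun t => ?_)
  have := Real.exp_pos (-t)
  positivity

theorem norm_altSquareGen_le {t : ℝ} (ht : 0 ≤ t) :
    ‖altSquareGen t‖ ≤ Real.exp (-t) * (1 - Real.exp (-t)) := by
  have hE : Real.exp (-t) ≤ 1 := Real.exp_le_one_iff.mpr (by linarith)
  have hp := Real.exp_pos (-t)
  rw [altSquareGen, Complex.norm_real, Real.norm_of_nonneg
    (div_nonneg (mul_nonneg hp.le (by linarith)) (by positivity))]
  exact div_le_self (mul_nonneg hp.le (by linarith)) (one_le_pow₀ (by linarith))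

/-- The function is O(t) at 0, so the half-plane of convergence contains s = 0. -/
theorem differentiableAt_mellin_altSquareGen {s : ℂ} (hs : -1 < s.re) :
    DifferentiableAt ℂ (mellin altSquareGen) s := by
  refine mellin_differentiableAt_of_isBigO_rpow_exp (a := 1) (b := -1) one_pos
    (continuous_altSquareGen.locallyIntegrable.locallyIntegrableOn _) ?_ ?_ hs
  · refine Asymptotics.IsBigO.of_bound 1 ?_
    filter_upwards [eventually_ge_atTop 0] with t ht
    rw [one_mul, Real.norm_of_nonneg (Real.exp_pos _).le, neg_one_mul]
    refine (norm_altSquareGen_le ht).trans (mul_le_of_le_one_right (Real.exp_pos _).le ?_)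
    linarith [Real.exp_pos (-t)]
  · refine Asymptotics.IsBigO.of_bound 1 ?_
    filter_upwards [self_mem_nhdsWithin] with t ht
    have ht' : (0 : ℝ) < t := ht
    rw [neg_neg, Real.rpow_one, one_mul, Real.norm_of_nonneg ht'.le]
    have hE : Real.exp (-t) ≤ 1 := Real.exp_le_one_iff.mpr (by linarith)
    have h1 := Real.add_one_le_exp (-t)
    refine (norm_altSquareGen_le ht'.le).trans ?_
    nlinarith [Real.exp_pos (-t)]

theorem mellin_altSquareGen_of_three_lt {s : ℂ} (hs : 3 < s.re) :
    mellin altSquareGen s =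
      -(Complex.Gamma s * HurwitzZeta.cosZeta ((1 / 2 : ℝ) : UnitAddCircle) (s - 2)) := by
  have hcos := HurwitzZeta.hasSum_nat_cosZeta (1 / 2) (s := s - 2) (by simp; linarith)
  have hterm : ∀ i : ℕ, ((Real.cos (2 * Real.pi * (1 / 2) * ((i + 1 : ℕ) : ℝ)) : ℂ) /
      ((i + 1 : ℕ) : ℂ) ^ (s - 2)) = -((-1) ^ i * ((i : ℂ) + 1) ^ 2 / ((i : ℂ) + 1) ^ s) := by
    intro i
    have h1 : ((i + 1 : ℕ) : ℂ) ≠ 0 := by exact_mod_cast i.succ_ne_zero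
    rw [show 2 * Real.pi * (1 / 2) * ((i + 1 : ℕ) : ℝ) = ((i + 1 : ℕ) : ℝ) * Real.pi by ring,
      Real.cos_nat_mul_pi, Complex.cpow_sub _ _ h1, show (2 : ℂ) = ((2 : ℕ) : ℂ) by norm_num,
      Complex.cpow_natCast]
    push_cast at h1 ⊢
    field_simp
    ring
  have h0 := (hasSum_nat_add_iff' 1).2 hcos
  have hs2 : s - 2 ≠ 0 := by
    intro h
    have := congrArg Complex.re h
    simp at this
    linarith
  rw [Finset.sum_range_one, Nat.cast_zero (R := ℂ), Complex.zero_cpow hs2, div_zero, sub_zero] at h0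
  have h2 : HasSum (fun i : ℕ => Complex.Gamma s * ((-1) ^ i * ((i : ℂ) + 1) ^ 2) /
      (((i : ℝ) + 1 : ℝ) : ℂ) ^ s) (mellin altSquareGen s) := by
    refine hasSum_mellin (p := fun i : ℕ => (i : ℝ) + 1) (fun i => Or.inr (by positivity))
      (by linarith) (fun t ht => hasSum_altSquareGen ht) ?_
    have h3 : Summable fun n : ℕ => 1 / (((n + 1 : ℕ) : ℝ)) ^ (s.re - 2) :=
      (summable_nat_add_iff 1).2 (Real.summable_one_div_nat_rpow.2 (by linarith))
    refine h3.congr fun i => ?_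
    have hi : (0 : ℝ) < (i : ℝ) + 1 := by positivity
    rw [norm_mul, norm_pow, norm_neg, norm_one, one_pow, one_mul, norm_pow,
      show ((i : ℂ) + 1) = (((i : ℝ) + 1 : ℝ) : ℂ) by push_cast; ring, Complex.norm_real,
      Real.norm_of_nonneg hi.le, Nat.cast_add_one, Real.rpow_sub hi,
      show (2 : ℝ) = ((2 : ℕ) : ℝ) by norm_num, Real.rpow_natCast, one_div_div]
  have h4 := h0.mul_left (-Complex.Gamma s)
  rw [← neg_mul]
  refine h2.unique (h4.congr_fun fun i => ?_)
  have := hterm i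
  rw [this]
  push_cast
  ring

theorem half_ne_zero_unitAddCircle : ((1 / 2 : ℝ) : UnitAddCircle) ≠ 0 := by
  intro h
  obtain ⟨n, hn⟩ := (AddCircle.coe_eq_zero_iff (1 : ℝ)).1 h
  rw [zsmul_eq_mul, mul_one] at hn
  have h2 : ((2 * n : ℤ) : ℝ) = ((1 : ℤ) : ℝ) := by push_cast; linarith
  have h3 : 2 * n = 1 := by exact_mod_cast h2
  omega

/-- Identity theorem from Re s > 3, where termwise integration converges absolutely. The domain
stops at Re s = 0 because of the pole of Γ. -/
theorem mellin_altSquareGen {s : ℂ} (hs : 0 < s.re) :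
    mellin altSquareGen s =
      -(Complex.Gamma s * HurwitzZeta.cosZeta ((1 / 2 : ℝ) : UnitAddCircle) (s - 2)) := by
  have hU : IsOpen {v : ℂ | 0 < v.re} := isOpen_lt continuous_const Complex.continuous_re
  have hc : IsPreconnected {v : ℂ | 0 < v.re} := (convex_halfSpace_re_gt 0).isPreconnected
  have h1 : AnalyticOnNhd ℂ (mellin altSquareGen) {v : ℂ | 0 < v.re} :=
    DifferentiableOn.analyticOnNhd (fun v hv =>
      (differentiableAt_mellin_altSquareGen (lt_trans (by norm_num) hv)).differentiableWithinAt) hU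
  have h2 : AnalyticOnNhd ℂ (fun s => -(Complex.Gamma s *
      HurwitzZeta.cosZeta ((1 / 2 : ℝ) : UnitAddCircle) (s - 2))) {v : ℂ | 0 < v.re} := by
    refine DifferentiableOn.analyticOnNhd (fun v hv => ?_) hU
    have hg : DifferentiableAt ℂ Complex.Gamma v := by
      refine Complex.differentiableAt_Gamma v fun m h => ?_
      have := congrArg Complex.re h
      have hv' : 0 < v.re := hv
      simp at this
      linarith [m.cast_nonneg (α := ℝ)]
    have hz : DifferentiableAt ℂ
        (fun s : ℂ => HurwitzZeta.cosZeta ((1 / 2 : ℝ) : UnitAddCircle) (s - 2)) v :=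
      (HurwitzZeta.differentiable_cosZeta_of_ne_zero half_ne_zero_unitAddCircle).comp
        (differentiable_id.sub_const 2) v
    exact (hg.mul hz).neg.differentiableWithinAt
  refine h1.eqOn_of_preconnected_of_eventuallyEq h2 hc (z₀ := 4) (by simp) ?_ hs
  filter_upwards [(isOpen_lt continuous_const Complex.continuous_re).mem_nhds
    (show (4 : ℂ) ∈ {v : ℂ | 3 < v.re} by norm_num)] with v hv
  exact mellin_altSquareGen_of_three_lt hv

/-- The functional equation produces Γ(s) sin(πs/2), which reflection rewrites without a singularity
at 0; the right side is thus continuous there. -/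
theorem mellin_altSquareGen_eq {s : ℂ} (h0 : 0 < s.re) (h1 : s.re < 1) :
    mellin altSquareGen s = Real.pi / (Complex.Gamma (1 - s) * Complex.cos (Real.pi * s / 2)) *
      (2 * Real.pi) ^ (-(3 - s)) * Complex.Gamma (3 - s) *
      HurwitzZeta.hurwitzZetaEven ((1 / 2 : ℝ) : UnitAddCircle) (3 - s) := by
  have hfe := HurwitzZeta.cosZeta_one_sub ((1 / 2 : ℝ) : UnitAddCircle) (s := 3 - s) (fun n h => by
    have := congrArg Complex.re h
    simp at this
    linarith [n.cast_nonneg (α := ℝ)])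
  have hg : Complex.Gamma (1 - s) ≠ 0 := Complex.Gamma_ne_zero_of_re_pos (by simp; linarith)
  have hrefl := Complex.Gamma_mul_Gamma_one_sub s
  have hsin : Complex.sin (Real.pi * s) ≠ 0 := by
    intro h
    rw [h, div_zero] at hrefl
    exact mul_ne_zero (Complex.Gamma_ne_zero_of_re_pos h0) hg hrefl
  have hsin2 : Complex.sin (Real.pi * s) =
      2 * Complex.sin (Real.pi * s / 2) * Complex.cos (Real.pi * s / 2) := by
    rw [← Complex.sin_two_mul]; congr 1; ring
  have hcos : Complex.cos (Real.pi * (3 - s) / 2) = -Complex.sin (Real.pi * s / 2) := by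
    rw [show (Real.pi : ℂ) * (3 - s) / 2 = (Real.pi / 2 - Real.pi * s / 2) + Real.pi by ring,
      Complex.cos_add_pi, Complex.cos_pi_div_two_sub]
  rw [mellin_altSquareGen h0, show s - 2 = 1 - (3 - s) by ring, hfe, hcos]
  rw [hsin2] at hsin hrefl
  have hc0 : Complex.cos (Real.pi * s / 2) ≠ 0 := right_ne_zero_of_mul hsin
  have key : 2 * Complex.Gamma s * Complex.sin (Real.pi * s / 2) =
      Real.pi / (Complex.Gamma (1 - s) * Complex.cos (Real.pi * s / 2)) := by
    rw [eq_div_iff (mul_ne_zero hg hc0)]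
    rw [eq_div_iff hsin] at hrefl
    linear_combination hrefl
  rw [← key]
  ring

theorem hasSum_riemannZeta_three : HasSum (fun n : ℕ => 1 / (n : ℂ) ^ 3) (riemannZeta 3) := by
  have hs : Summable fun n : ℕ => 1 / (n : ℂ) ^ 3 := by
    have := Complex.summable_ofReal.2 (Real.summable_one_div_nat_pow.2 (by norm_num : 1 < 3))
    refine this.congr fun n => ?_
    push_cast
    rfl
  have hz := zeta_nat_eq_tsum_of_gt_one (k := 3) (by norm_num)
  rw [Nat.cast_ofNat] at hz
  rw [hz]
  exact hs.hasSum

theorem hasSum_hurwitzZetaEven_half_three :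
    HasSum (fun k : ℕ => 1 / ((2 * k + 1 : ℕ) : ℂ) ^ 3)
      (1 / 8 * HurwitzZeta.hurwitzZetaEven ((1 / 2 : ℝ) : UnitAddCircle) 3) := by
  have h := HurwitzZeta.hasSum_nat_hurwitzZetaEven_of_mem_Icc (a := 1 / 2) (by norm_num)
    (s := 3) (by norm_num)
  refine (h.mul_left (1 / 8)).congr_fun fun k => ?_
  rw [Complex.cpow_ofNat, Complex.cpow_ofNat]
  push_cast
  have h1 : (2 * (k : ℂ) + 1) ≠ 0 := by exact_mod_cast (by omega : 2 * k + 1 ≠ 0)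
  have e : (k : ℂ) + 1 - 1 / 2 = (2 * k + 1) / 2 := by ring
  have e' : (k : ℂ) + 1 / 2 = (2 * k + 1) / 2 := by ring
  rw [e, e']
  field_simp
  norm_num

theorem hurwitzZetaEven_half_three :
    HurwitzZeta.hurwitzZetaEven ((1 / 2 : ℝ) : UnitAddCircle) 3 = 7 * riemannZeta 3 := by
  have he : HasSum (fun k : ℕ => 1 / ((2 * k : ℕ) : ℂ) ^ 3) (1 / 8 * riemannZeta 3) := by
    refine (hasSum_riemannZeta_three.mul_left (1 / 8)).congr_fun fun k => ?_
    push_cast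
    rw [mul_pow, one_div_mul_one_div]
    norm_num
  have := hasSum_riemannZeta_three.unique (HasSum.even_add_odd (f := fun n : ℕ => 1 / (n : ℂ) ^ 3)
    he hasSum_hurwitzZetaEven_half_three)
  linear_combination 8 * (-this)

/-- Both sides of `mellin_altSquareGen_eq` are continuous at 0, so they are compared along s =
1/(n+1). -/
theorem mellin_altSquareGen_zero :
    mellin altSquareGen 0 = 7 * riemannZeta 3 / (4 * (Real.pi : ℂ) ^ 2) := by
  have hpi : (Real.pi : ℂ) ≠ 0 := by exact_mod_cast Real.pi_ne_zero
  set F : ℂ → ℂ := fun s => Real.pi / (Complex.Gamma (1 - s) * Complex.cos (Real.pi * s / 2)) *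
      (2 * Real.pi) ^ (-(3 - s)) * Complex.Gamma (3 - s) *
      HurwitzZeta.hurwitzZetaEven ((1 / 2 : ℝ) : UnitAddCircle) (3 - s) with hF
  have hG : ∀ v : ℂ, 0 < v.re → ContinuousAt Complex.Gamma v := fun v hv => by
    refine (Complex.differentiableAt_Gamma v fun m h => ?_).continuousAt
    have := congrArg Complex.re h
    simp at this
    linarith [m.cast_nonneg (α := ℝ)]
  have hFc : ContinuousAt F 0 := by
    have c1 : ContinuousAt (fun s : ℂ => Complex.Gamma (1 - s)) 0 :=
      ContinuousAt.comp (f := fun s : ℂ => 1 - s) (hG _ (by simp)) (by fun_prop)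
    have c3 : ContinuousAt (fun s : ℂ => Complex.Gamma (3 - s)) 0 :=
      ContinuousAt.comp (f := fun s : ℂ => 3 - s) (hG _ (by simp)) (by fun_prop)
    have ch : ContinuousAt (fun s : ℂ =>
        HurwitzZeta.hurwitzZetaEven ((1 / 2 : ℝ) : UnitAddCircle) (3 - s)) 0 :=
      ContinuousAt.comp (f := fun s : ℂ => 3 - s)
        (HurwitzZeta.differentiableAt_hurwitzZetaEven _ (by norm_num)).continuousAt (by fun_prop)
    have cp : ContinuousAt (fun s : ℂ => (2 * (Real.pi : ℂ)) ^ (-(3 - s))) 0 :=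
      ContinuousAt.const_cpow (by fun_prop) (Or.inl (mul_ne_zero two_ne_zero hpi))
    refine (((continuousAt_const.div (c1.mul (by fun_prop)) ?_).mul cp).mul c3).mul ch
    simp
  have hF0 : F 0 = 7 * riemannZeta 3 / (4 * (Real.pi : ℂ) ^ 2) := by
    simp only [hF, sub_zero, hurwitzZetaEven_half_three]
    rw [show (-3 : ℂ) = ((-3 : ℤ) : ℂ) by norm_num, Complex.cpow_intCast,
      show (3 : ℂ) = ((2 : ℕ) : ℂ) + 1 by norm_num, Complex.Gamma_nat_eq_factorial]
    norm_num [zpow_neg]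
    field_simp
    ring
  have hseq : Tendsto (fun n : ℕ => (((1 / ((n : ℝ) + 1) : ℝ)) : ℂ)) atTop (𝓝 0) := by
    exact_mod_cast (Complex.continuous_ofReal.tendsto 0).comp
      (tendsto_one_div_add_atTop_nhds_zero_nat (𝕜 := ℝ))
  have l1 := (differentiableAt_mellin_altSquareGen (s := 0) (by simp)).continuousAt.tendsto.comp hseq
  have l2 := hFc.tendsto.comp hseq
  rw [← hF0]
  refine tendsto_nhds_unique l1 (l2.congr' ?_)
  filter_upwards [eventually_gt_atTop 0] with n hn
  have hn' : (0 : ℝ) < n := by exact_mod_cast hn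
  simp only [Function.comp]
  rw [mellin_altSquareGen_eq]
  · rw [Complex.ofReal_re]; positivity
  · rw [Complex.ofReal_re, div_lt_one (by positivity)]; linarith

/-- Here 2cosh(t/2)-2 = (1-p)²/p with p = e^{-t/2}, so the integrand is 4 `altSquareGen` (t/2)/t. At
s = 0 the Mellin transform is invariant under scaling. -/
theorem tailIntegral_half_zero :
    tailIntegral (1 / 2) 0 = 7 * riemannZeta 3 / (Real.pi : ℂ) ^ 2 := by
  have h := mellin_comp_mul_left altSquareGen 0 (a := 1 / 2) (by norm_num)
  rw [neg_zero, Complex.cpow_zero, one_smul, mellin_altSquareGen_zero] at h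
  have h2 : tailIntegral (1 / 2) 0 = 4 * mellin (fun t => altSquareGen (1 / 2 * t)) 0 := by
    rw [tailIntegral, mellin, ← integral_const_mul]
    refine setIntegral_congr_fun measurableSet_Ioi fun t ht => ?_
    have h1 : (t : ℂ) ≠ 0 := by exact_mod_cast (ne_of_gt ht)
    have hp : 0 < 1 - Real.exp (-(t / 2)) := one_sub_exp_neg_pos (half_pos ht)
    have h2 : (1 - (Real.exp (-(t / 2)) : ℂ)) ≠ 0 := by exact_mod_cast hp.ne'
    have h3 : (1 + (Real.exp (-(t / 2)) : ℂ)) ≠ 0 := by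
      have := Real.exp_pos (-(t / 2)); exact_mod_cast (by positivity : (1 + Real.exp (-(t / 2))) ≠ 0)
    have h4 : Real.exp (-(((0 : ℕ) : ℝ) + 1) * t) = Real.exp (-(t / 2)) ^ 2 := by
      rw [← Real.exp_nat_mul]; congr 1; push_cast; ring
    have h5 : Complex.exp (1 / 2 * t) = (Real.exp (-(t / 2)) : ℂ)⁻¹ := by
      rw [Complex.ofReal_exp, ← Complex.exp_neg]; congr 1; push_cast; ring
    have h6 : Complex.exp (-(1 / 2 * t)) = (Real.exp (-(t / 2)) : ℂ) := by
      rw [Complex.ofReal_exp]; congr 1; push_cast; ring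
    have h7 : (Real.exp (-(t / 2)) : ℂ) ≠ 0 := by exact_mod_cast (Real.exp_pos _).ne'
    simp only [Complex.cosh, h4, h5, h6, tailKernel, altSquareGen, neg_div, zero_sub,
      Complex.cpow_neg_one, smul_eq_mul, show 1 / 2 * t = t / 2 by ring]
    generalize Real.exp (-(t / 2)) = p at *
    push_cast at h2 h3 ⊢
    field_simp
    ring
  rw [h2, h]
  have hpi : (Real.pi : ℂ) ≠ 0 := by exact_mod_cast Real.pi_ne_zero
  field_simp

/-! ### The constant Q(0) -/

/-- Positivity selects the square root when Q(0) is recovered from Q(0)². -/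
theorem multiGamma_three_three_halves : ∃ r : ℝ, 0 < r ∧ multiGamma 3 (3 / 2) = r := by
  have h := multiGamma_eq_multiGammaBinet 3 (1 / 2) 0 (by norm_num)
  rw [show (1 : ℂ) + 1 / 2 + (0 : ℕ) = 3 / 2 by norm_num] at h
  have h0 : logNewton 3 (1 / 2) 0 = 0 := by simp [logNewton, multiGammaNat_zero_right]
  have hI : ∃ r : ℝ, binetIntegral 3 (1 / 2) (((0 : ℕ) : ℝ) + 1) = r := by
    -- The coefficients 1, 1/2, -1/8, 1/16 are the binomials C(1/2,j).
    refine ⟨∫ t in Ioi (0 : ℝ), (Real.exp (-(((0 : ℕ) : ℝ) + 1) * t) *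
      ((Real.exp (-(1 / 2) * t) - (1 + 1 / 2 * (Real.exp (-t) - 1) - 1 / 8 * (Real.exp (-t) - 1) ^ 2
        + 1 / 16 * (Real.exp (-t) - 1) ^ 3)) / (t * (1 - Real.exp (-t)) ^ 3))), ?_⟩
    rw [← integral_complex_ofReal, binetIntegral]
    refine setIntegral_congr_fun measurableSet_Ioi fun t _ => ?_
    simp only [binetKernel, binomRem, Finset.sum_range_succ, Finset.sum_range_zero,
      Ring.choose_zero_right, Ring.choose_one_right, Complex.choose_two, Complex.choose_three]
    push_cast
    ring
  obtain ⟨r, hr⟩ := hI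
  refine ⟨Real.exp r, Real.exp_pos r, ?_⟩
  rw [h, multiGammaBinet, h0, hr, zero_add, Complex.ofReal_exp]

theorem gammaQuotient_zero_eq : gammaQuotient 0 = (multiGamma 3 (3 / 2) ^ 16)⁻¹ := by
  simp only [gammaQuotient, barnesG, add_zero, sub_zero, multiGamma_one_right]
  rw [inv_one, one_mul, one_pow, one_mul, one_div, inv_pow, ← sq, ← pow_mul]

/-- The recurrence reduces every argument to 1, 2 or 3/2; the powers of Γ_2(3/2) cancel and Γ(1/2)²
= π. -/
theorem gammaQuotient_half_eq :
    gammaQuotient (1 / 2) = (Real.pi : ℂ) ^ 2 * multiGamma 3 (3 / 2) ^ 16 := by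
  have h2 : multiGamma 2 (1 / 2) = Complex.Gamma (1 / 2) * multiGamma 2 (3 / 2) := by
    have := multiGamma_recurrence 1 (1 / 2)
    rw [multiGamma] at this
    rw [this]; norm_num
  have h3 : multiGamma 3 (1 / 2) = multiGamma 2 (1 / 2) * multiGamma 3 (3 / 2) := by
    rw [multiGamma_recurrence 2 (1 / 2)]; norm_num
  have h4 : multiGamma 3 2 = 1 := by
    have := multiGamma_recurrence 2 1
    rw [multiGamma_one_right, multiGamma_one_right, one_mul] at this
    rw [this]; norm_num
  have hne : multiGamma 2 (3 / 2) ≠ 0 := by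
    have := multiGamma_eq_multiGammaBinet 2 (1 / 2) 0 (by norm_num)
    rw [show (1 : ℂ) + 1 / 2 + (0 : ℕ) = 3 / 2 by norm_num] at this
    rw [this]
    exact multiGammaBinet_ne_zero _ _ _
  have hG : Complex.Gamma (1 / 2) ^ 2 = Real.pi := by
    rw [Complex.Gamma_one_half_eq, show (1 / 2 : ℂ) = ((2 : ℕ) : ℂ)⁻¹ by norm_num,
      Complex.cpow_nat_inv_pow _ two_ne_zero]
  have hG0 : Complex.Gamma (1 / 2) ≠ 0 := by
    intro h
    rw [h, zero_pow two_ne_zero] at hG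
    exact Real.pi_ne_zero (by exact_mod_cast hG.symm)
  rw [gammaQuotient, barnesG, barnesG]
  rw [show (1 : ℂ) + 1 / 2 = 3 / 2 by norm_num, show (1 : ℂ) - 1 / 2 = 1 / 2 by norm_num,
    show (3 / 2 : ℂ) - 1 / 2 = 1 by norm_num, show (3 / 2 : ℂ) + 1 / 2 = 2 by norm_num,
    h4, multiGamma_one_right, h3, h2, ← hG]
  field_simp

theorem gammaQuotient_zero : gammaQuotient 0 =
    Real.pi * Complex.exp (-(7 * riemannZeta 3 / (2 * (Real.pi : ℂ) ^ 2))) := by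
  obtain ⟨r, hr, h3⟩ := multiGamma_three_three_halves
  have h1 := gammaQuotient_eq_headProd (x := 1 / 2) (M := 0) (by norm_num) (by norm_num)
    (fun m h => by
      have := congrArg Complex.re h
      simp at this
      linarith [m.cast_nonneg (α := ℝ)])
    (fun m h => by
      have := congrArg Complex.re h
      simp at this
      linarith [m.cast_nonneg (α := ℝ)])
  rw [tailIntegral_half_zero, gammaQuotient_half_eq, gammaQuotient_zero_eq, headProd,
    Finset.prod_range_zero, mul_one, h3] at h1
  rw [gammaQuotient_zero_eq, h3]
  obtain ⟨z, hz⟩ : ∃ z : ℝ, riemannZeta 3 = z := by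
    have := zeta_nat_eq_tsum_of_gt_one (k := 3) (by norm_num)
    rw [Nat.cast_ofNat] at this
    refine ⟨∑' n : ℕ, 1 / (n : ℝ) ^ 3, this.trans ?_⟩
    push_cast
    rfl
  rw [hz] at h1 ⊢
  have h2 : Real.pi ^ 2 * r ^ 16 = (r ^ 16)⁻¹ * Real.exp (7 * z / Real.pi ^ 2) := by
    exact_mod_cast h1
  have h4 : (r ^ 16)⁻¹ = Real.pi * Real.exp (-(7 * z / (2 * Real.pi ^ 2))) := by
    rw [← sq_eq_sq₀ (by positivity) (by positivity), mul_pow, ← Real.exp_nat_mul,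
      show ((2 : ℕ) : ℝ) * -(7 * z / (2 * Real.pi ^ 2)) = -(7 * z / Real.pi ^ 2) by
        push_cast; field_simp, Real.exp_neg]
    have := Real.exp_pos (7 * z / Real.pi ^ 2)
    field_simp at h2 ⊢
    linear_combination -h2
  exact_mod_cast congrArg (Complex.ofReal) h4

/-! ### Euler's cosine product and the conclusion -/

theorem prod_range_two_mul_factor (x : ℂ) (n : ℕ) :
    ∏ j ∈ Finset.range (2 * n), (1 - (2 * x) ^ 2 / ((j : ℂ) + 1) ^ 2) =
      (∏ i ∈ Finset.range n, (1 - 4 * x ^ 2 / (2 * (i : ℂ) + 1) ^ 2)) *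
        ∏ i ∈ Finset.range n, (1 - x ^ 2 / ((i : ℂ) + 1) ^ 2) := by
  induction n with
  | zero => simp
  | succ n ih =>
    have h1 : ((n : ℂ) + 1) ≠ 0 := by exact_mod_cast n.succ_ne_zero
    have h2 : (2 * x) ^ 2 / (((2 * n + 1 : ℕ) : ℂ) + 1) ^ 2 = x ^ 2 / ((n : ℂ) + 1) ^ 2 := by
      push_cast
      rw [show (2 * (n : ℂ) + 1 + 1) = 2 * (n + 1) by ring]
      field_simp
    rw [show 2 * (n + 1) = 2 * n + 1 + 1 by ring, Finset.prod_range_succ, Finset.prod_range_succ, ih,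
      h2, Finset.prod_range_succ, Finset.prod_range_succ]
    push_cast
    ring

/-- From cos πx = sin 2πx / (2 sin πx): the even factors of the sine product at 2x are those of the
sine product at x. -/
theorem Complex.tendsto_euler_cos_prod {x : ℂ} (hx : x = 0 ∨ Complex.sin (Real.pi * x) ≠ 0) :
    Tendsto (fun n : ℕ => ∏ i ∈ Finset.range n, (1 - 4 * x ^ 2 / (2 * (i : ℂ) + 1) ^ 2)) atTop
      (𝓝 (Complex.cos (Real.pi * x))) := by
  rcases hx with rfl | hx
  · simp
  have h1 := Complex.tendsto_euler_sin_prod x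
  have h2 := (Complex.tendsto_euler_sin_prod (2 * x)).comp
    (tendsto_id.const_mul_atTop' (two_pos : (0 : ℕ) < 2))
  have h3 := h2.div (h1.const_mul 2) (mul_ne_zero two_ne_zero hx)
  have hlim : Complex.sin (Real.pi * (2 * x)) / (2 * Complex.sin (Real.pi * x)) =
      Complex.cos (Real.pi * x) := by
    rw [show (Real.pi : ℂ) * (2 * x) = 2 * (Real.pi * x) by ring, Complex.sin_two_mul]
    field_simp
  rw [hlim] at h3
  refine h3.congr' ?_
  filter_upwards [h1.eventually_ne hx] with n hn
  simp only [Function.comp, id, Pi.div_apply]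
  rw [prod_range_two_mul_factor, div_eq_iff (mul_ne_zero two_ne_zero hn)]
  ring

/-- For odd k = 2i+3, k² = 4(i+1)(i+2) + 1: the first part is the exponent in `headProd`, the 1 goes
to the cosine product. The factor k = 2N+1 is supplied on the left to pair with the last even one.
-/
theorem prod_Icc_eq_headProd (x : ℂ) (N : ℕ) :
    (∏ k ∈ Finset.Icc 1 (2 * N), (1 - 4 * x ^ 2 / (k : ℂ) ^ 2) ^ (-(k : ℤ) ^ 2 * (-1) ^ k)) *
      (1 - 4 * x ^ 2 / (2 * (N : ℂ) + 1) ^ 2) ^ ((2 * N + 1) ^ 2) =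
    headProd x N * ∏ i ∈ Finset.range (N + 1), (1 - 4 * x ^ 2 / (2 * (i : ℂ) + 1) ^ 2) := by
  induction N with
  | zero => simp [headProd]
  | succ N ih =>
    have h1 : (-1 : ℤ) ^ (2 * N + 1) = -1 := by rw [pow_succ, pow_mul]; norm_num
    have h2 : (-1 : ℤ) ^ (2 * N + 1 + 1) = 1 := by rw [pow_succ, h1]; norm_num
    have h3 : ((N : ℂ) + 1) ≠ 0 := by exact_mod_cast N.succ_ne_zero
    have h4 : 4 * x ^ 2 / ((2 * N + 1 + 1 : ℕ) : ℂ) ^ 2 = x ^ 2 / ((N : ℂ) + 1) ^ 2 := by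
      push_cast
      rw [show (2 * (N : ℂ) + 1 + 1) = 2 * (N + 1) by ring]
      field_simp
      ring
    have e1 : -((2 * N + 1 : ℕ) : ℤ) ^ 2 * (-1) = (((2 * N + 1) ^ 2 : ℕ) : ℤ) := by push_cast; ring
    have e2 : -((2 * N + 1 + 1 : ℕ) : ℤ) ^ 2 * 1 = -((4 * (N + 1) ^ 2 : ℕ) : ℤ) := by push_cast; ring
    have e3 : 2 * ((N + 1 : ℕ) : ℂ) + 1 = 2 * N + 3 := by push_cast; ring
    rw [show 2 * (N + 1) = 2 * N + 1 + 1 by ring, Finset.prod_Icc_succ_top (by omega),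
      Finset.prod_Icc_succ_top (by omega), h1, h2, h4, e1, e2, zpow_natCast, zpow_neg, zpow_natCast,
      Finset.prod_range_succ, headProd, Finset.prod_range_succ, ← headProd, e3, ← inv_pow,
      show (2 * N + 1 + 1 + 1) ^ 2 = 4 * (N + 1) * (N + 2) + 1 by ring,
      pow_succ _ (4 * (N + 1) * (N + 2))]
    rw [show ((2 * N + 1 : ℕ) : ℂ) = 2 * N + 1 by push_cast; ring]
    generalize (1 - 4 * x ^ 2 / (2 * (N : ℂ) + 3) ^ 2) = v
    generalize (1 - x ^ 2 / ((N : ℂ) + 1) ^ 2)⁻¹ ^ (4 * (N + 1) ^ 2) = u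
    generalize v ^ (4 * (N + 1) * (N + 2)) = V
    linear_combination (u * (V * v)) * ih

theorem proposition6 (x : ℂ) (hx : -(1 / 2 : ℝ) < x.re) (hx' : ∀ m : ℕ, 1 ≤ m → x ≠ (m : ℂ)) :
    Filter.Tendsto
      (fun N : ℕ => ∏ k ∈ Finset.Icc 1 (2 * N),
        (1 - 4 * x ^ 2 / (k : ℂ) ^ 2) ^ (-(k : ℤ) ^ 2 * (-1) ^ k))
      Filter.atTop
      (nhds
        (Complex.cos (Real.pi * x) / Real.pi *
          Complex.exp (2 * x ^ 2 + 7 * riemannZeta 3 / (2 * (Real.pi : ℂ) ^ 2)) *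
          (barnesG (1 + x) * barnesG (1 - x)) ^ 4 *
          (multiGamma 3 (1 - x) * multiGamma 3 (1 + x) /
            (multiGamma 3 (3 / 2 - x) * multiGamma 3 (3 / 2 + x))) ^ 8)) := by
  have hpi : (Real.pi : ℂ) ≠ 0 := by exact_mod_cast Real.pi_ne_zero
  have hp : ∀ m : ℕ, 1 + x + m ≠ 0 := fun m h => by
    have := congrArg Complex.re h
    simp at this
    linarith [m.cast_nonneg (α := ℝ)]
  have hm : ∀ m : ℕ, 1 + -x + m ≠ 0 := fun m h =>
    hx' (m + 1) (by omega) (by push_cast; linear_combination -h)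
  -- Re x > -1/2 rules out the negative integers, so 0 is the only admissible zero of the sine.
  have hsin : x = 0 ∨ Complex.sin (Real.pi * x) ≠ 0 := by
    by_cases h0 : x = 0
    · exact Or.inl h0
    right
    intro h
    obtain ⟨k, hk⟩ := Complex.sin_eq_zero_iff.1 h
    have hk' : x = k := mul_left_cancel₀ hpi (by rw [hk]; ring)
    rcases lt_trichotomy k 0 with hk0 | hk0 | hk0
    · rw [hk', Complex.intCast_re] at hx
      have : (k : ℝ) ≤ -1 := by exact_mod_cast (by omega : k ≤ -1)
      linarith
    · exact h0 (by rw [hk', hk0, Int.cast_zero])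
    · obtain ⟨m, rfl⟩ := Int.eq_ofNat_of_zero_le hk0.le
      exact hx' m (by omega) (by rw [hk']; simp)
  have hcos := (tendsto_add_atTop_iff_nat 1).2 (Complex.tendsto_euler_cos_prod hsin)
  have hlast : Tendsto (fun N : ℕ => (1 - 4 * x ^ 2 / (2 * (N : ℂ) + 1) ^ 2) ^ ((2 * N + 1) ^ 2)) atTop
      (𝓝 (Complex.exp (-(4 * x ^ 2)))) := by
    have hN : Tendsto (fun N : ℕ => (2 * N + 1) ^ 2) atTop atTop :=
      tendsto_atTop_mono (fun N => show N ≤ (2 * N + 1) ^ 2 by nlinarith) tendsto_id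
    -- This is (1 - 4x²/m)^m along m = (2N+1)².
    refine ((Complex.tendsto_one_add_div_pow_exp (-(4 * x ^ 2))).comp hN).congr fun N => ?_
    simp only [Function.comp]
    push_cast
    rw [neg_div, ← sub_eq_add_neg]
  have hquot0 : gammaQuotient 0 ≠ 0 := by
    rw [gammaQuotient_zero]; exact mul_ne_zero hpi (Complex.exp_ne_zero _)
  have hhead : Tendsto (fun N : ℕ => headProd x N) atTop
      (𝓝 (gammaQuotient x / gammaQuotient 0 * Complex.exp (-(2 * x ^ 2)))) := by
    refine ((tendsto_tailIntegral x).neg.cexp.const_mul _).congr' ?_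
    filter_upwards [tendsto_natCast_atTop_atTop.eventually_gt_atTop |x.re|] with N hN
    rw [abs_lt] at hN
    rw [gammaQuotient_eq_headProd (M := N) (by linarith) (by linarith) hp hm, Complex.exp_neg]
    field_simp
  have hlim := (hhead.mul hcos).div hlast (Complex.exp_ne_zero _)
  have hval : gammaQuotient x / gammaQuotient 0 * Complex.exp (-(2 * x ^ 2)) *
      Complex.cos (Real.pi * x) / Complex.exp (-(4 * x ^ 2)) =
      Complex.cos (Real.pi * x) / Real.pi *
          Complex.exp (2 * x ^ 2 + 7 * riemannZeta 3 / (2 * (Real.pi : ℂ) ^ 2)) *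
          (barnesG (1 + x) * barnesG (1 - x)) ^ 4 *
          (multiGamma 3 (1 - x) * multiGamma 3 (1 + x) /
            (multiGamma 3 (3 / 2 - x) * multiGamma 3 (3 / 2 + x))) ^ 8 := by
    rw [mul_assoc _ ((barnesG (1 + x) * barnesG (1 - x)) ^ 4), ← gammaQuotient, gammaQuotient_zero,
      Complex.exp_add, Complex.exp_neg (7 * _ / _), Complex.exp_neg, Complex.exp_neg (4 * _),
      show 4 * x ^ 2 = 2 * x ^ 2 + 2 * x ^ 2 by ring, Complex.exp_add (2 * x ^ 2)]
    field_simp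
  rw [← hval]
  refine hlim.congr' ?_
  filter_upwards [hlast.eventually_ne (Complex.exp_ne_zero _)] with N hN
  simp only [Pi.div_apply]
  rw [← prod_Icc_eq_headProd, mul_div_cancel_right₀ _ hN]
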